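/- For an integer $k\ge 2$ put $d=2k-1$ and define the hypergraph $L_d$ as follows. Its vertices are $2d(4k-2)$ distinct elements $v^i_j$ and $w^i_j$ with $i\in[d]$ and $j\in[4k-2]$. For $i\in[d]$ let $$P_i=\{\{v^i_j,v^i_{j+1}\}:1\le j\le 4k-3\},\qquad Q_i=\{\{w^i_j,w^i_{j+1}\}:1\le j\le 4k-3\}.$$ For families $A_1,\dots,A_l$ of sets write $A_1*\cdots*A_l=\{e_1\cup\cdots\cup e_l: e_i\in A_i \text{ for all } i\}$. Let $$K_1=\bigcup_{1\le i_1<\cdots<i_k\le d}P_{i_1}*\cdots*P_{i_k},\qquad K_2=\bigcup_{1\le i_1<\cdots<i_k\le d}Q_{i_1}*\cdots*Q_{i_k},$$ $$M_1=\{\{v^i_1,v^i_3,\dots,v^i_{2k-1}\},\{v^i_{2k},v^i_{2k+2},\dots,v^i_{4k-2}\}:i\in[d]\},$$ $$M_2=\{\{w^i_1,w^i_3,\dots,w^i_{2k-1}\},\{w^i_{2k},w^i_{2k+2},\dots,w^i_{4k-2}\}:i\in[d]\}.$$ The set of hyperedges of $L_d$ is $K_1\cup K_2\cup (M_1*M_2)$.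 Proposition. For every odd $d\ge 3$, the hypergraph $L_d$ is $(d+1)$-uniform and geometrically embeddable in $\mathbb{R}^d$; that is, there is an injective map $\phi$ from the vertex set of $L_d$ to $\mathbb{R}^d$ such that $\dim\operatorname{aff}(\phi(e))=d$ for every hyperedge $e$, and $$\operatorname{conv}(\phi(e_1))\cap\operatorname{conv}(\phi(e_2))=\operatorname{conv}(\phi(e_1)\cap\phi(e_2))$$ for all hyperedges $e_1,e_2$. -/

import Mathlib

namespace GeomHypergraph

/-- `H` is `k`-uniform: every hyperedge has exactly `k` vertices. -/
def IsUniform {α : Type*} (H : Hypergraph α) (k : ℕ) : Prop :=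
  ∀ e ∈ H.edgeSet, e.encard = k

/-- A `k`-uniform hypergraph `H` (with `1 ≤ k`) is geometrically embeddable in `ℝ^d`: it is
`k`-uniform and its vertices can be placed at distinct points of `ℝ^d` so that every hyperedge
spans an affine subspace of dimension `k - 1`, and the convex hulls of any two hyperedges intersect
exactly in the convex hull of their common vertices. -/
def GeometricallyEmbeddable {α : Type*} (H : Hypergraph α) (k d : ℕ) : Prop :=
  IsUniform H k ∧
  ∃ φ : α → EuclideanSpace ℝ (Fin d),
    Set.InjOn φ H.vertexSet ∧
    (∀ e ∈ H.edgeSet, Module.finrank ℝ (affineSpan ℝ (φ '' e)).direction + 1 = k) ∧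
    (∀ e₁ ∈ H.edgeSet, ∀ e₂ ∈ H.edgeSet,
      convexHull ℝ (φ '' e₁) ∩ convexHull ℝ (φ '' e₂) = convexHull ℝ (φ '' e₁ ∩ φ '' e₂))

/-- The abstract join of a family of set systems: all unions of one member from each. -/
def abstractJoin {ι α : Type*} (F : ι → Set (Set α)) : Set (Set α) :=
  {e | ∃ f : ι → Set α, (∀ i, f i ∈ F i) ∧ e = ⋃ i, f i}

/-- Vertices: `(0, i, j)` is the vertex `v` and `(1, i, j)` the vertex `w` with upper index `i + 1`
and lower index `j + 1` (so upper indices run over `1, …, 2k - 1` and lower ones over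
`1, …, 4k - 2`). -/
abbrev Vertex (k : ℕ) : Type := Fin 2 × Fin (2 * k - 1) × Fin (4 * k - 2)

/-- The edge set of the `i`-th path on side `s`, i.e. `P_i` for `s = 0` and `Q_i` for `s = 1`. -/
def pathEdges (k : ℕ) (s : Fin 2) (i : Fin (2 * k - 1)) : Set (Set (Vertex k)) :=
  {e | ∃ a b : Fin (4 * k - 2), (b : ℕ) = a + 1 ∧ e = {(s, i, a), (s, i, b)}}

/-- `K_1` (`s = 0`) and `K_2` (`s = 1`): the union of the joins of the `k` paths with indices
`i_1 < ⋯ < i_k`, over all such choices of indices. -/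
def K (k : ℕ) (s : Fin 2) : Set (Set (Vertex k)) :=
  ⋃ (i : Fin k → Fin (2 * k - 1)) (_ : StrictMono i),
    abstractJoin (fun t : Fin k => pathEdges k s (i t))

/-- The vertices of the `i`-th path on side `s` with lower indices `1, 3, …, 2k - 1`. -/
def oddPart (k : ℕ) (s : Fin 2) (i : Fin (2 * k - 1)) : Set (Vertex k) :=
  {x | ∃ j : Fin (4 * k - 2), Odd ((j : ℕ) + 1) ∧ (j : ℕ) + 1 ≤ 2 * k - 1 ∧ x = (s, i, j)}

/-- The vertices of the `i`-th path on side `s` with lower indices `2k, 2k + 2, …, 4k - 2`. -/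
def evenPart (k : ℕ) (s : Fin 2) (i : Fin (2 * k - 1)) : Set (Vertex k) :=
  {x | ∃ j : Fin (4 * k - 2), Even ((j : ℕ) + 1) ∧ 2 * k ≤ (j : ℕ) + 1 ∧ x = (s, i, j)}

/-- `M_1` (`s = 0`) and `M_2` (`s = 1`). -/
def M (k : ℕ) (s : Fin 2) : Set (Set (Vertex k)) :=
  {e | ∃ i : Fin (2 * k - 1), e = oddPart k s i ∨ e = evenPart k s i}

/-- The hypergraph `L_d` for odd `d = 2k - 1`, on all vertices of both sides, with hyperedges
`K_1 ∪ K_2 ∪ M_1 * M_2`. -/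
def L (d : ℕ) : Hypergraph (Vertex ((d + 1) / 2)) where
  vertexSet := Set.univ
  edgeSet := K ((d + 1) / 2) 0 ∪ K ((d + 1) / 2) 1 ∪ abstractJoin (M ((d + 1) / 2))
  subset_vertexSet_of_mem_edgeSet' := fun _ _ => Set.subset_univ _

end GeomHypergraph

/-! ### Convex hulls, separating functionals and affine independence -/

namespace GeomHypergraph

open Filter Module

/-! The hulls of two placed vertex sets meet exactly in the hull of their common points once an
affine functional is nonnegative on one set, nonpositive on the other, and vanishes on the first
only at shared vertices (`convexHull_inter_of_separates`). The proof is a search for such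
functionals.

Both sides are placed near the origin and side `1` is then translated by `R • u` with `R` large.
Pairs inside one `K` do not notice this, and `K_1`, `K_2` drift apart. For an edge of `K` against `S
∪ T` it is enough to separate it from the part on its own side, by a functional whose sign on `u`
sends the other part to the correct side. For two members of `M_1 * M_2`, a functional killing `u`
may use a separate constant on each side; a tilt of size `1 / R` reconciles the constants
(`eventually_separable_M_M`). `IsSeparated` lists what the placement must provide, and
`geometricallyEmbeddable_of_isSeparated` draws the conclusion.

For `k ≥ 3` the vertices lie on the moment curve, where affine functionals are polynomials of degree
at most `d` (`isSeparated_momentPlacement`). An edge of `K` is a union of consecutive pairs, hence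
the zero set, on its side, of a monic polynomial of degree `d + 1` that is nonnegative at integers;
differences of two such polynomials separate edges. Against a matching set a quartic suffices,
because an edge meets its block in at most one consecutive pair. Matching sets are ordered along the
curve and separated from each other by polynomials of degree below `d`.

For `k = 2` a quartic exceeds the degree `3`. There each path is a convex arc over one of three rays
whose directions sum to zero, and a functional restricts to a quadratic on each arc: the linear
coefficients are free up to zero sum, the leading ones are proportional to widely spaced curvatures
(`isSeparated_arcPlacement`). -/

/-- The function `f` is nonnegative on `A`, nonpositive on `B`, and its zeros on `A` lie in `B`. -/
def Separates {α : Type*} (f : α → ℝ) (A B : Set α) : Prop :=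
  (∀ x ∈ A, 0 ≤ f x) ∧ (∀ x ∈ B, f x ≤ 0) ∧ ∀ x ∈ A, f x = 0 → x ∈ B

/-- The function `f` is positive on `A` and negative on `B`. -/
def StrictlySeparates {α : Type*} (f : α → ℝ) (A B : Set α) : Prop :=
  (∀ x ∈ A, 0 < f x) ∧ ∀ x ∈ B, f x < 0

theorem StrictlySeparates.separates {α : Type*} {f : α → ℝ} {A B : Set α}
    (h : StrictlySeparates f A B) : Separates f A B :=
  ⟨fun x hx => (h.1 x hx).le, fun x hx => (h.2 x hx).le,
    fun x hx h0 => absurd h0 (h.1 x hx).ne'⟩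

/-- A face of a convex hull cut out by a supporting affine functional is spanned by the points on
the supporting hyperplane. -/
theorem mem_convexHull_of_supporting {α E : Type*} [AddCommGroup E] [Module ℝ E] {φ : α → E}
    {A : Set α} (a : ℝ) (g : E →ₗ[ℝ] ℝ) (h0 : ∀ x ∈ A, 0 ≤ a + g (φ x)) {y : E}
    (hy : y ∈ convexHull ℝ (φ '' A)) (hle : a + g y ≤ 0) :
    y ∈ convexHull ℝ (φ '' {x ∈ A | a + g (φ x) = 0}) := by
  rw [mem_convexHull_iff_exists_fintype] at hy
  obtain ⟨ι, _, w, z, hw0, hw1, hz, rfl⟩ := hy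
  have hsum : a + g (∑ i, w i • z i) = ∑ i, w i * (a + g (z i)) := by
    simp only [map_sum, map_smul, smul_eq_mul, mul_add, Finset.sum_add_distrib, ← Finset.sum_mul,
      hw1, one_mul]
  have hnn : ∀ i, 0 ≤ a + g (z i) := by
    intro i
    obtain ⟨x, hx, hxz⟩ := hz i
    rw [← hxz]
    exact h0 x hx
  have hzero : ∀ i, w i * (a + g (z i)) = 0 := by
    have h1 : ∑ i, w i * (a + g (z i)) = 0 :=
      le_antisymm (hsum ▸ hle) (Finset.sum_nonneg fun i _ => mul_nonneg (hw0 i) (hnn i))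
    have h2 := (Finset.sum_eq_zero_iff_of_nonneg
      (fun i _ => mul_nonneg (hw0 i) (hnn i))).1 h1
    exact fun i => h2 i (Finset.mem_univ i)
  have hfilter : ∑ i, w i • z i = ∑ i ∈ Finset.univ.filter (fun i => w i ≠ 0), w i • z i := by
    rw [Finset.sum_filter_of_ne]
    intro i _ hi hwi
    exact hi (by rw [hwi, zero_smul])
  have hfilter1 : ∑ i ∈ Finset.univ.filter (fun i => w i ≠ 0), w i = 1 := by
    rw [← hw1, Finset.sum_filter_of_ne]
    intro i _ hi
    exact hi
  rw [hfilter]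
  refine (convex_convexHull ℝ _).sum_mem (fun i _ => hw0 i) hfilter1 fun i hi => ?_
  obtain ⟨x, hx, hxz⟩ := hz i
  refine subset_convexHull ℝ _ ⟨x, ⟨hx, ?_⟩, hxz⟩
  rw [hxz]
  exact (mul_eq_zero.1 (hzero i)).resolve_left (Finset.mem_filter.1 hi).2

/-- A point of both hulls has value at most zero, so it lies on the face of the first hull cut out
by the functional, and the vertices of that face belong to `B`. -/
theorem convexHull_inter_of_separates {α E : Type*} [AddCommGroup E] [Module ℝ E] {φ : α → E}
    {A B : Set α} (a : ℝ) (g : E →ₗ[ℝ] ℝ) (h : Separates (fun x => a + g (φ x)) A B) :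
    convexHull ℝ (φ '' A) ∩ convexHull ℝ (φ '' B) = convexHull ℝ (φ '' A ∩ φ '' B) := by
  apply Set.Subset.antisymm
  · rintro y ⟨hyA, hyB⟩
    have hle : a + g y ≤ 0 := by
      have hconv : Convex ℝ {y : E | g y ≤ -a} := convex_halfSpace_le g.isLinear (-a)
      have hsub : convexHull ℝ (φ '' B) ⊆ {y : E | g y ≤ -a} := by
        refine convexHull_min ?_ hconv
        rintro _ ⟨x, hx, rfl⟩
        have := h.2.1 x hx
        simp only [Set.mem_ofPred_eq]
        linarith
      have := hsub hyB
      simp only [Set.mem_ofPred_eq] at this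
      linarith
    refine convexHull_mono ?_ (mem_convexHull_of_supporting a g h.1 hyA hle)
    rintro _ ⟨x, ⟨hx, hx0⟩, rfl⟩
    exact ⟨⟨x, hx, rfl⟩, ⟨x, h.2.2 x hx hx0, rfl⟩⟩
  · exact Set.subset_inter (convexHull_mono Set.inter_subset_left)
      (convexHull_mono Set.inter_subset_right)

/-- Points are affinely independent when each of them can be isolated by an affine functional
vanishing at the others. -/
theorem affineIndependent_of_isolating {α E : Type*} [AddCommGroup E] [Module ℝ E] {φ : α → E}
    {A : Set α} (h : ∀ x ∈ A, ∃ (a : ℝ) (g : E →ₗ[ℝ] ℝ), a + g (φ x) ≠ 0 ∧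
      ∀ y ∈ A, y ≠ x → a + g (φ y) = 0) :
    AffineIndependent ℝ (fun x : A => φ x) := by
  rw [affineIndependent_iff]
  intro s w hw0 hw x hx
  obtain ⟨a, g, hne, hz⟩ := h x x.2
  have h1 : ∑ y ∈ s, w y * (a + g (φ y)) = 0 := by
    have h2 : g (∑ y ∈ s, w y • φ y) = 0 := by rw [hw, map_zero]
    simp only [map_sum, map_smul, smul_eq_mul] at h2
    simp only [mul_add, Finset.sum_add_distrib, ← Finset.sum_mul, hw0, h2]
    simp
  rw [Finset.sum_eq_single_of_mem x hx] at h1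
  · exact (mul_eq_zero.1 h1).resolve_right hne
  · intro y _ hyx
    rw [hz y y.2 (fun he => hyx (Subtype.ext he)), mul_zero]

/-- The determinant is a polynomial in `R` with value `1` at `R = 0`, so it has finitely many roots.
-/
theorem eventually_det_one_add_smul_ne_zero {ι : Type*} [Fintype ι] [DecidableEq ι]
    (N : Matrix ι ι ℝ) : ∀ᶠ R : ℝ in atTop, (1 + R • N).det ≠ 0 := by
  set P : Polynomial ℝ := (1 + (Polynomial.X : Polynomial ℝ) • N.map Polynomial.C).det with hP
  have heval : ∀ R : ℝ, P.eval R = (1 + R • N).det := by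
    intro R
    have := (Polynomial.evalRingHom R).map_det
      (1 + (Polynomial.X : Polynomial ℝ) • N.map Polynomial.C)
    rw [Polynomial.coe_evalRingHom, ← hP] at this
    rw [this]
    congr 1
    ext i j
    by_cases hij : i = j <;> simp [hij, mul_comm R]
  have hP0 : P ≠ 0 := by
    intro h
    have := heval 0
    simp [h] at this
  filter_upwards [Polynomial.eventually_atTop_not_isRoot P hP0] with R hR h0
  exact hR (by rw [Polynomial.IsRoot.def, heval, h0])

/-- Linear independence survives adding large multiples of fixed vectors. -/
theorem eventually_linearIndependent_add_smul {ι E : Type*} [Finite ι] [AddCommGroup E]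
    [Module ℝ E] {v : ι → E} (hv : LinearIndependent ℝ v) (n : ι → E) :
    ∀ᶠ R : ℝ in atTop, LinearIndependent ℝ (fun i => v i + R • n i) := by
  classical
  have := Fintype.ofFinite ι
  obtain ⟨Λ, hΛ⟩ := (Fintype.linearCombination ℝ v).exists_leftInverse_of_injective
    (LinearMap.ker_eq_bot.2 (linearIndependent_iff_injective_fintypeLinearCombination.1 hv))
  have hΛv : ∀ i, Λ (v i) = Pi.single i 1 := by
    intro i
    have := LinearMap.congr_fun hΛ (Pi.single i 1)
    simpa [Fintype.linearCombination_apply_single] using this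
  -- `Λ` maps the `v i` to the standard basis, so the perturbed vectors become the rows of `1 + R •
  -- N`.
  filter_upwards [eventually_det_one_add_smul_ne_zero (Matrix.of fun i => Λ (n i))] with R hR
  have hrow := Matrix.linearIndependent_rows_of_det_ne_zero hR
  refine LinearIndependent.of_comp Λ ?_
  have hfun : (Λ ∘ fun i => v i + R • n i) =
      fun i => (1 + R • Matrix.of fun i => Λ (n i)) i := by
    ext i j
    simp [hΛv, Matrix.one_apply, Pi.single_apply, eq_comm]
  rw [hfun]
  exact hrow

/-- Homogenisation: the extra coordinate `1` encodes that the weights sum to zero. -/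
theorem affineIndependent_iff_linearIndependent_prod {ι E : Type*} [AddCommGroup E] [Module ℝ E]
    {v : ι → E} :
    AffineIndependent ℝ v ↔ LinearIndependent ℝ (fun i => ((1 : ℝ), v i)) := by
  rw [affineIndependent_iff, linearIndependent_iff']
  refine forall₂_congr fun s w => ?_
  simp only [Prod.smul_mk, smul_eq_mul, mul_one, Prod.ext_iff, Prod.fst_sum, Prod.snd_sum,
    Prod.fst_zero, Prod.snd_zero]
  exact ⟨fun h h' => h h'.1 h'.2, fun h h1 h2 => h ⟨h1, h2⟩⟩

theorem eventually_affineIndependent_add_smul {ι E : Type*} [Finite ι] [AddCommGroup E]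
    [Module ℝ E] {v : ι → E} (hv : AffineIndependent ℝ v) (n : ι → E) :
    ∀ᶠ R : ℝ in atTop, AffineIndependent ℝ (fun i => v i + R • n i) := by
  rw [affineIndependent_iff_linearIndependent_prod] at hv
  filter_upwards [eventually_linearIndependent_add_smul hv fun i => ((0 : ℝ), n i)] with R hR
  rw [affineIndependent_iff_linearIndependent_prod]
  simpa using hR

/-- The affine span of `n + 1` affinely independent points has dimension `n`. -/
theorem finrank_direction_affineSpan_image {α E : Type*} [AddCommGroup E] [Module ℝ E] {φ : α → E}
    {A : Set α} {n : ℕ} (hA : A.encard = n + 1)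
    (h : AffineIndependent ℝ (fun x : A => φ x)) :
    finrank ℝ (affineSpan ℝ (φ '' A)).direction = n := by
  have hfin : A.Finite := Set.finite_of_encard_eq_coe (k := n + 1) (by exact_mod_cast hA)
  have := hfin.fintype
  have hcard : Fintype.card A = n + 1 := by
    have h1 := Set.encard_eq_coe_toFinset_card A
    rw [hA, Set.toFinset_card] at h1
    exact_mod_cast h1.symm
  rw [direction_affineSpan, ← h.finrank_vectorSpan hcard]
  rw [Set.image_eq_range]

end GeomHypergraph

/-! ### Combinatorics of the hyperedges and the conditions on a placement -/

namespace GeomHypergraph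

open Filter Module

/-- The underlying hypergraph of `L d`, indexed by `k = (d + 1) / 2`. -/
def pathHypergraph (k : ℕ) : Hypergraph (Vertex k) where
  vertexSet := Set.univ
  edgeSet := K k 0 ∪ K k 1 ∪ abstractJoin (M k)
  subset_vertexSet_of_mem_edgeSet' := fun _ _ => Set.subset_univ _

/-- The `h`-th half-matching set of the `i`-th path on side `s`: the odd part for `h = 0` and the
even part for `h = 1`. -/
def half (k : ℕ) (s : Fin 2) (i : Fin (2 * k - 1)) (h : Fin 2) : Set (Vertex k) :=
  {x | x.1 = s ∧ x.2.1 = i ∧ ∃ m < k, (x.2.2 : ℕ) = h * (2 * k - 1) + 2 * m}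

theorem oddPart_eq_half (k : ℕ) (s : Fin 2) (i : Fin (2 * k - 1)) :
    oddPart k s i = half k s i 0 := by
  ext ⟨s', i', j⟩
  simp only [oddPart, half, Set.mem_ofPred_eq, Prod.mk.injEq]
  constructor
  · rintro ⟨j', ⟨m, hm⟩, hle, rfl, rfl, rfl⟩
    exact ⟨rfl, rfl, m, by omega, by simp; omega⟩
  · rintro ⟨rfl, rfl, m, hm, hj⟩
    simp at hj
    exact ⟨j, ⟨m, by omega⟩, by omega, rfl, rfl, rfl⟩

theorem evenPart_eq_half (k : ℕ) (s : Fin 2) (i : Fin (2 * k - 1)) :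
    evenPart k s i = half k s i 1 := by
  ext ⟨s', i', j⟩
  simp only [evenPart, half, Set.mem_ofPred_eq, Prod.mk.injEq]
  constructor
  · rintro ⟨j', ⟨m, hm⟩, hle, rfl, rfl, rfl⟩
    exact ⟨rfl, rfl, m - k, by omega, by simp; omega⟩
  · rintro ⟨rfl, rfl, m, hm, hj⟩
    simp at hj
    exact ⟨j, ⟨m + k, by omega⟩, by omega, rfl, rfl, rfl⟩

theorem mem_M_iff {k : ℕ} {s : Fin 2} {S : Set (Vertex k)} :
    S ∈ M k s ↔ ∃ i h, S = half k s i h := by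
  simp only [M, Set.mem_ofPred_eq, oddPart_eq_half, evenPart_eq_half, Fin.exists_fin_two]

theorem mem_join_M_iff {k : ℕ} {e : Set (Vertex k)} :
    e ∈ abstractJoin (M k) ↔ ∃ S ∈ M k 0, ∃ T ∈ M k 1, e = S ∪ T := by
  simp only [abstractJoin, Set.mem_ofPred_eq]
  constructor
  · rintro ⟨f, hf, rfl⟩
    refine ⟨f 0, hf 0, f 1, hf 1, ?_⟩
    ext x
    simp [Fin.exists_fin_two]
  · rintro ⟨S, hS, T, hT, rfl⟩
    refine ⟨![S, T], ?_, ?_⟩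
    · rw [Fin.forall_fin_two]
      exact ⟨hS, hT⟩
    · ext x
      simp [Fin.exists_fin_two]

/-- A hyperedge of `K k s` consists of one pair of consecutive vertices on each of `k` paths. -/
theorem mem_K_iff {k : ℕ} {s : Fin 2} {A : Set (Vertex k)} :
    A ∈ K k s ↔ ∃ (i : Fin k → Fin (2 * k - 1)) (a b : Fin k → Fin (4 * k - 2)), StrictMono i ∧
      (∀ t, (b t : ℕ) = a t + 1) ∧
      A = {x | ∃ t, x = (s, i t, a t) ∨ x = (s, i t, b t)} := by
  simp only [K, abstractJoin, pathEdges, Set.mem_iUnion, Set.mem_ofPred_eq]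
  constructor
  · rintro ⟨i, hi, f, hf, rfl⟩
    choose a b hab hf using hf
    refine ⟨i, a, b, hi, hab, ?_⟩
    ext x
    simp [hf]
  · rintro ⟨i, a, b, hi, hab, rfl⟩
    refine ⟨i, hi, fun t => {(s, i t, a t), (s, i t, b t)}, fun t => ⟨a t, b t, hab t, rfl⟩, ?_⟩
    ext x
    simp

theorem side_of_mem_K {k : ℕ} {s : Fin 2} {A : Set (Vertex k)} (hA : A ∈ K k s) {x : Vertex k}
    (hx : x ∈ A) : x.1 = s := by
  obtain ⟨i, a, b, -, -, rfl⟩ := mem_K_iff.1 hA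
  obtain ⟨t, rfl | rfl⟩ := hx <;> rfl

theorem side_of_mem_M {k : ℕ} {s : Fin 2} {S : Set (Vertex k)} (hS : S ∈ M k s) {x : Vertex k}
    (hx : x ∈ S) : x.1 = s := by
  obtain ⟨i, h, rfl⟩ := mem_M_iff.1 hS
  exact hx.1

theorem encard_of_mem_K {k : ℕ} {s : Fin 2} {A : Set (Vertex k)} (hA : A ∈ K k s) :
    A.encard = (2 * k : ℕ) := by
  obtain ⟨i, a, b, hi, hab, rfl⟩ := mem_K_iff.1 hA
  have hinj : Function.Injective
      (fun p : Fin k × Bool => ((s, i p.1, if p.2 then b p.1 else a p.1) : Vertex k)) := by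
    rintro ⟨t, p⟩ ⟨t', p'⟩ h
    simp only [Prod.mk.injEq, true_and] at h
    obtain rfl := hi.injective h.1
    have h2 := congrArg Fin.val h.2
    have := hab t
    cases p <;> cases p' <;> simp only [Bool.false_eq_true, if_true, if_false] at h2 <;>
      first | rfl | omega
  have := hinj.encard_image Set.univ
  rw [Set.image_univ, Set.encard_univ, ENat.card_eq_coe_fintype_card, Fintype.card_prod, Fintype.card_fin, Fintype.card_bool] at this
  refine Eq.trans ?_ (this.trans (congrArg _ (mul_comm k 2)))
  congr 1
  ext x
  constructor
  · rintro ⟨t, rfl | rfl⟩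
    · exact ⟨(t, false), rfl⟩
    · exact ⟨(t, true), rfl⟩
  · rintro ⟨⟨t, _ | _⟩, rfl⟩
    · exact ⟨t, Or.inl rfl⟩
    · exact ⟨t, Or.inr rfl⟩

theorem encard_of_mem_M {k : ℕ} {s : Fin 2} {S : Set (Vertex k)} (hS : S ∈ M k s) :
    S.encard = k := by
  obtain ⟨i, h, rfl⟩ := mem_M_iff.1 hS
  have hlt : ∀ m : Fin k, (h : ℕ) * (2 * k - 1) + 2 * m < 4 * k - 2 := by
    intro m
    have := m.2
    obtain rfl | rfl := (by omega : h = 0 ∨ h = 1) <;> simp <;> omega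
  have hinj : Function.Injective (fun m : Fin k => ((s, i, ⟨_, hlt m⟩) : Vertex k)) := by
    intro m m' h
    simp only [Prod.mk.injEq, true_and, Fin.mk.injEq] at h
    exact Fin.ext (by omega)
  have := hinj.encard_image Set.univ
  rw [Set.image_univ, Set.encard_univ, ENat.card_eq_coe_fintype_card, Fintype.card_fin] at this
  rw [← this]
  congr 1
  ext ⟨s', i', j⟩
  simp only [half, Set.mem_ofPred_eq, Set.mem_range, Prod.mk.injEq, Fin.ext_iff]
  constructor
  · rintro ⟨h1, h2, m, hm, h3⟩
    exact ⟨⟨m, hm⟩, h1.symm, h2.symm, h3.symm⟩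
  · rintro ⟨m, h1, h2, h3⟩
    exact ⟨h1.symm, h2.symm, m, m.2, h3.symm⟩

theorem encard_union_of_mem_M {k : ℕ} {S T : Set (Vertex k)} (hS : S ∈ M k 0) (hT : T ∈ M k 1) :
    (S ∪ T).encard = (2 * k : ℕ) := by
  rw [Set.encard_union_eq, encard_of_mem_M hS, encard_of_mem_M hT]
  · push_cast
    ring
  · rw [Set.disjoint_left]
    intro x hx hx'
    have h1 := side_of_mem_M hS hx
    rw [side_of_mem_M hT hx'] at h1
    exact absurd h1 (by decide)

theorem isUniform_pathHypergraph (k : ℕ) : IsUniform (pathHypergraph k) (2 * k) := by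
  rintro e ((he | he) | he)
  · exact encard_of_mem_K he
  · exact encard_of_mem_K he
  · obtain ⟨S, hS, T, hT, rfl⟩ := mem_join_M_iff.1 he
    exact encard_union_of_mem_M hS hT

/-- The sign attached to a side. -/
def sideSign (s : Fin 2) : ℝ := if s = 0 then 1 else -1

@[simp] theorem sideSign_zero : sideSign 0 = 1 := rfl

@[simp] theorem sideSign_one : sideSign 1 = -1 := rfl

/-- The placement that moves the vertices of side `1` by `R • u`. -/
def shifted {k : ℕ} {E : Type*} [AddCommGroup E] [Module ℝ E] (x : Vertex k → E) (u : E) (R : ℝ)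
    (v : Vertex k) : E :=
  if v.1 = 0 then x v else x v + R • u

section shifted

variable {k : ℕ} {E : Type*} [AddCommGroup E] [Module ℝ E] {x : Vertex k → E} {u : E}

theorem shifted_of_side_zero {R : ℝ} {v : Vertex k} (hv : v.1 = 0) : shifted x u R v = x v :=
  if_pos hv

theorem shifted_of_side_one {R : ℝ} {v : Vertex k} (hv : v.1 = 1) :
    shifted x u R v = x v + R • u :=
  if_neg (by rw [hv]; decide)

/-- A placement of both sides near the origin from which the hypergraph can be embedded by moving
side `1` far away in direction `u`. -/
structure IsSeparated (x : Vertex k → E) (u : E) : Prop where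
  injOn : ∀ s, Set.InjOn x {v | v.1 = s}
  exists_height : ∃ ℓ : E →ₗ[ℝ] ℝ, ℓ u = 1
  sep_K_K : ∀ s, ∀ A ∈ K k s, ∀ B ∈ K k s, ∃ (a : ℝ) (g : E →ₗ[ℝ] ℝ),
    Separates (fun v => a + g (x v)) A B
  -- The sign of `g u` puts the part of an edge of `M_1 * M_2` on the opposite side strictly below
  -- zero after a large shift.
  sep_K_M : ∀ s, ∀ A ∈ K k s, ∀ S ∈ M k s, ∃ (a : ℝ) (g : E →ₗ[ℝ] ℝ),
    sideSign s * g u < 0 ∧ Separates (fun v => a + g (x v)) A S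
  -- As `g u = 0`, the shift leaves `g` unchanged, and `a₀`, `a₁` need not agree.
  sep_M_M : ∀ S ∈ M k 0, ∀ S' ∈ M k 0, ∀ T ∈ M k 1, ∀ T' ∈ M k 1, S ≠ S' ∨ T ≠ T' →
    ∃ (a₀ a₁ : ℝ) (g : E →ₗ[ℝ] ℝ), g u = 0 ∧
      (S = S' ∧ (∀ v ∈ S, a₀ + g (x v) = 0) ∨ StrictlySeparates (fun v => a₀ + g (x v)) S S') ∧
      (T = T' ∧ (∀ v ∈ T, a₁ + g (x v) = 0) ∨ StrictlySeparates (fun v => a₁ + g (x v)) T T')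
  -- Provides the tilt that reconciles `a₀` with `a₁` without disturbing a matching set common to
  -- both hyperedges.
  vanish_M : ∀ s, ∀ S ∈ M k s, ∃ (a : ℝ) (g : E →ₗ[ℝ] ℝ), g u = 1 ∧ ∀ v ∈ S, a + g (x v) = 0
  indep_K : ∀ s, ∀ A ∈ K k s, AffineIndependent ℝ (fun v : A => x v)
  indep_M : ∀ S ∈ M k 0, ∀ T ∈ M k 1,
    ∀ᶠ R : ℝ in atTop, AffineIndependent ℝ (fun v : ↥(S ∪ T) => shifted x u R v)

end shifted

end GeomHypergraph

/-! ### Embedding by moving side `1` far away -/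

namespace GeomHypergraph

open Filter Module

theorem eventually_add_mul_neg (a : ℝ) {c : ℝ} (hc : c < 0) :
    ∀ᶠ R : ℝ in atTop, a + R * c < 0 := by
  have h : Tendsto (fun R : ℝ => a + R * c) atTop atBot :=
    tendsto_atBot_add_const_left _ _ (tendsto_id.atTop_mul_const_of_neg hc)
  exact h.eventually_lt_atBot 0

theorem eventually_pos_add_div {a : ℝ} (ha : 0 < a) (c : ℝ) :
    ∀ᶠ R : ℝ in atTop, 0 < a + c / R := by
  have h : Tendsto (fun R : ℝ => a + c / R) atTop (nhds (a + 0)) :=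
    tendsto_const_nhds.add (tendsto_const_nhds.div_atTop tendsto_id)
  rw [add_zero] at h
  exact h.eventually_const_lt ha

section

variable {k : ℕ} {E : Type*} [AddCommGroup E] [Module ℝ E] {x : Vertex k → E} {u : E}

/-- Translating one whole side is absorbed by the constant term. -/
theorem exists_separates_shifted {s : Fin 2} {A B : Set (Vertex k)} (hA : ∀ v ∈ A, v.1 = s)
    (hB : ∀ v ∈ B, v.1 = s) {a : ℝ} {g : E →ₗ[ℝ] ℝ} (h : Separates (fun v => a + g (x v)) A B)
    (R : ℝ) :
    ∃ a' : ℝ, Separates (fun v => a' + g (shifted x u R v)) A B := by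
  have key : ∃ a' : ℝ, ∀ v : Vertex k, v.1 = s → a' + g (shifted x u R v) = a + g (x v) := by
    obtain rfl | rfl := (by omega : s = 0 ∨ s = 1)
    · exact ⟨a, fun v hv => by rw [shifted_of_side_zero hv]⟩
    · refine ⟨a - R * g u, fun v hv => ?_⟩
      rw [shifted_of_side_one hv, map_add, map_smul, smul_eq_mul]
      ring
  obtain ⟨a', ha'⟩ := key
  refine ⟨a', fun v hv => ?_, fun v hv => ?_, fun v hv h0 => ?_⟩
  · beta_reduce
    rw [ha' v (hA v hv)]
    exact h.1 v hv
  · beta_reduce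
    rw [ha' v (hB v hv)]
    exact h.2.1 v hv
  · beta_reduce at h0
    rw [ha' v (hA v hv)] at h0
    exact h.2.2 v hv h0

/-- The statement that some affine functional separates the placed sets `A` and `B`. -/
def Separable (φ : Vertex k → E) (A B : Set (Vertex k)) : Prop :=
  ∃ (a : ℝ) (g : E →ₗ[ℝ] ℝ), Separates (fun v => a + g (φ v)) A B

/-- With `C` bounding the unshifted heights, `C - ℓ` separates as soon as `R > 2 * C`. -/
theorem eventually_separable_K_K (hx : IsSeparated x u) {A B : Set (Vertex k)} (hA : A ∈ K k 0)
    (hB : B ∈ K k 1) : ∀ᶠ R : ℝ in atTop, Separable (shifted x u R) A B := by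
  obtain ⟨ℓ, hℓ⟩ := hx.exists_height
  obtain ⟨C, hC⟩ : ∃ C : ℝ, ∀ v, |ℓ (x v)| < C := by
    obtain ⟨C, hC⟩ := (Set.finite_range fun v => |ℓ (x v)|).bddAbove
    exact ⟨C + 1, fun v => (hC ⟨v, rfl⟩).trans_lt (lt_add_one C)⟩
  filter_upwards [eventually_gt_atTop (2 * C)] with R hR
  refine ⟨C, -ℓ, StrictlySeparates.separates ⟨fun v hv => ?_, fun v hv => ?_⟩⟩
  · have := abs_lt.1 (hC v)
    beta_reduce
    rw [shifted_of_side_zero (side_of_mem_K hA hv), LinearMap.neg_apply]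
    linarith
  · have := abs_lt.1 (hC v)
    beta_reduce
    rw [shifted_of_side_one (side_of_mem_K hB hv), LinearMap.neg_apply, map_add, map_smul, hℓ,
      smul_eq_mul]
    linarith

/-- The functional for `A` and `S` is kept; on `T` it gains the term `R * g u` with `g u < 0`. -/
theorem eventually_separable_K_M_zero (hx : IsSeparated x u) {A S T : Set (Vertex k)}
    (hA : A ∈ K k 0) (hS : S ∈ M k 0) (hT : T ∈ M k 1) :
    ∀ᶠ R : ℝ in atTop, Separable (shifted x u R) A (S ∪ T) := by
  obtain ⟨a, g, hg, h⟩ := hx.sep_K_M 0 A hA S hS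
  rw [sideSign_zero, one_mul] at hg
  have hev : ∀ᶠ R : ℝ in atTop, ∀ v, a + g (x v) + R * g u < 0 :=
    eventually_all.2 fun v => eventually_add_mul_neg _ hg
  filter_upwards [hev] with R hR
  refine ⟨a, g, fun v hv => ?_, fun v hv => ?_, fun v hv h0 => ?_⟩
  · beta_reduce
    rw [shifted_of_side_zero (side_of_mem_K hA hv)]
    exact h.1 v hv
  · obtain hv | hv := hv
    · beta_reduce
      rw [shifted_of_side_zero (side_of_mem_M hS hv)]
      exact h.2.1 v hv
    · beta_reduce
      rw [shifted_of_side_one (side_of_mem_M hT hv), map_add, map_smul, smul_eq_mul, ← add_assoc]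
      exact (hR v).le
  · beta_reduce at h0
    rw [shifted_of_side_zero (side_of_mem_K hA hv)] at h0
    exact Or.inl (h.2.2 v hv h0)

/-- Here the constant is lowered by `R * g u`, so side `1` keeps its values and side `0` receives
the large negative term. -/
theorem eventually_separable_K_M_one (hx : IsSeparated x u) {A S T : Set (Vertex k)}
    (hA : A ∈ K k 1) (hS : S ∈ M k 0) (hT : T ∈ M k 1) :
    ∀ᶠ R : ℝ in atTop, Separable (shifted x u R) A (S ∪ T) := by
  obtain ⟨a, g, hg, h⟩ := hx.sep_K_M 1 A hA T hT
  rw [sideSign_one, neg_one_mul] at hg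
  have hev : ∀ᶠ R : ℝ in atTop, ∀ v, a + g (x v) + R * (-g u) < 0 :=
    eventually_all.2 fun v => eventually_add_mul_neg _ hg
  have hone : ∀ R : ℝ, ∀ v : Vertex k, v.1 = 1 →
      a - R * g u + g (shifted x u R v) = a + g (x v) := by
    intro R v hv
    rw [shifted_of_side_one hv, map_add, map_smul, smul_eq_mul]
    ring
  filter_upwards [hev] with R hR
  refine ⟨a - R * g u, g, fun v hv => ?_, fun v hv => ?_, fun v hv h0 => ?_⟩
  · beta_reduce
    rw [hone R v (side_of_mem_K hA hv)]
    exact h.1 v hv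
  · obtain hv | hv := hv
    · beta_reduce
      rw [shifted_of_side_zero (side_of_mem_M hS hv)]
      linarith [hR v]
    · beta_reduce
      rw [hone R v (side_of_mem_M hT hv)]
      exact h.2.1 v hv
  · beta_reduce at h0
    rw [hone R v (side_of_mem_K hA hv)] at h0
    exact Or.inr (h.2.2 v hv h0)

/-- The functional `g + (δ / R) • h` takes the value `δ = a₁ - a₀` on `R • u`, which turns the
constant `a₀` of side `0` into `a₁` on side `1`. The remaining error `δ * (b + h) / R` is too small
to change a strict sign. -/
theorem eventually_separable_M_M (hx : IsSeparated x u) {S S' T T' : Set (Vertex k)}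
    (hS : S ∈ M k 0) (hS' : S' ∈ M k 0) (hT : T ∈ M k 1) (hT' : T' ∈ M k 1)
    (hne : S ≠ S' ∨ T ≠ T') :
    ∀ᶠ R : ℝ in atTop, Separable (shifted x u R) (S ∪ T) (S' ∪ T') := by
  obtain ⟨a₀, a₁, g, hg, h₀, h₁⟩ := hx.sep_M_M S hS S' hS' T hT T' hT' hne
  -- At most one of `S = S'`, `T = T'` holds, so `b + h` can be made to vanish on the shared set,
  -- where `g` leaves no room for an error.
  obtain ⟨b, h, hh, hbS, hbT⟩ : ∃ (b : ℝ) (h : E →ₗ[ℝ] ℝ), h u = 1 ∧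
      (S = S' → ∀ v ∈ S, b + h (x v) = 0) ∧ (T = T' → ∀ v ∈ T, b + h (x v) = 0) := by
    by_cases hSS : S = S'
    · obtain ⟨b, h, hh, hb⟩ := hx.vanish_M 0 S hS
      exact ⟨b, h, hh, fun _ => hb, fun he => absurd he (hne.resolve_left (not_not.2 hSS))⟩
    · obtain ⟨b, h, hh, hb⟩ := hx.vanish_M 1 T hT
      exact ⟨b, h, hh, fun he => absurd he hSS, fun _ => hb⟩
  set δ := a₁ - a₀ with hδ
  have hev : ∀ᶠ R : ℝ in atTop, ∀ v : Vertex k, ∀ a : ℝ,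
      a = a₀ ∨ a = a₁ → (0 < a + g (x v) → 0 < a + g (x v) + δ * (b + h (x v)) / R) ∧
        (a + g (x v) < 0 → a + g (x v) + δ * (b + h (x v)) / R < 0) := by
    refine eventually_all.2 fun v => ?_
    have hpt : ∀ a : ℝ, ∀ᶠ R : ℝ in atTop,
        (0 < a + g (x v) → 0 < a + g (x v) + δ * (b + h (x v)) / R) ∧
        (a + g (x v) < 0 → a + g (x v) + δ * (b + h (x v)) / R < 0) := by
      intro a
      refine Eventually.and ?_ ?_
      · rw [eventually_imp_distrib_left]
        exact fun hp => eventually_pos_add_div hp _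
      · rw [eventually_imp_distrib_left]
        intro hp
        filter_upwards [eventually_pos_add_div (neg_pos.2 hp) (-(δ * (b + h (x v))))] with R hR
        rw [neg_div] at hR
        linarith
    filter_upwards [hpt a₀, hpt a₁] with R h0 h1
    rintro a (rfl | rfl)
    · exact h0
    · exact h1
  filter_upwards [hev, eventually_gt_atTop 0] with R hR hR0
  have hzero : ∀ v : Vertex k, v.1 = 0 →
      a₀ + δ * b / R + (g + (δ / R) • h) (shifted x u R v) =
        a₀ + g (x v) + δ * (b + h (x v)) / R := by
    intro v hv
    rw [shifted_of_side_zero hv, LinearMap.add_apply, LinearMap.smul_apply, smul_eq_mul]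
    ring
  have hone : ∀ v : Vertex k, v.1 = 1 →
      a₀ + δ * b / R + (g + (δ / R) • h) (shifted x u R v) =
        a₁ + g (x v) + δ * (b + h (x v)) / R := by
    intro v hv
    rw [shifted_of_side_one hv, LinearMap.add_apply, LinearMap.smul_apply, smul_eq_mul,
      map_add, map_add, map_smul, map_smul, hg, hh, smul_eq_mul, smul_eq_mul, hδ]
    field_simp
    ring
  refine ⟨a₀ + δ * b / R, g + (δ / R) • h, ?_, ?_, ?_⟩
  · rintro v (hv | hv)
    · beta_reduce
      rw [hzero v (side_of_mem_M hS hv)]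
      obtain ⟨he, hz⟩ | hs := h₀
      · rw [hz v hv, hbS he v hv]
        simp
      · exact ((hR v a₀ (Or.inl rfl)).1 (hs.1 v hv)).le
    · beta_reduce
      rw [hone v (side_of_mem_M hT hv)]
      obtain ⟨he, hz⟩ | hs := h₁
      · rw [hz v hv, hbT he v hv]
        simp
      · exact ((hR v a₁ (Or.inr rfl)).1 (hs.1 v hv)).le
  · rintro v (hv | hv)
    · beta_reduce
      rw [hzero v (side_of_mem_M hS' hv)]
      obtain ⟨he, hz⟩ | hs := h₀
      · rw [← he] at hv
        rw [hz v hv, hbS he v hv]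
        simp
      · exact ((hR v a₀ (Or.inl rfl)).2 (hs.2 v hv)).le
    · beta_reduce
      rw [hone v (side_of_mem_M hT' hv)]
      obtain ⟨he, hz⟩ | hs := h₁
      · rw [← he] at hv
        rw [hz v hv, hbT he v hv]
        simp
      · exact ((hR v a₁ (Or.inr rfl)).2 (hs.2 v hv)).le
  · rintro v (hv | hv) h0
    · beta_reduce at h0
      rw [hzero v (side_of_mem_M hS hv)] at h0
      obtain ⟨he, hz⟩ | hs := h₀
      · exact Or.inl (he ▸ hv)
      · exact absurd h0 ((hR v a₀ (Or.inl rfl)).1 (hs.1 v hv)).ne'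
    · beta_reduce at h0
      rw [hone v (side_of_mem_M hT hv)] at h0
      obtain ⟨he, hz⟩ | hs := h₁
      · exact Or.inr (he ▸ hv)
      · exact absurd h0 ((hR v a₁ (Or.inr rfl)).1 (hs.1 v hv)).ne'

theorem eventually_injective_shifted (hx : IsSeparated x u) :
    ∀ᶠ R : ℝ in atTop, Function.Injective (shifted x u R) := by
  obtain ⟨ℓ, hℓ⟩ := hx.exists_height
  have hev : ∀ᶠ R : ℝ in atTop, ∀ v w, ℓ (x v) - ℓ (x w) < R :=
    eventually_all.2 fun v => eventually_all.2 fun w => eventually_gt_atTop _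
  filter_upwards [hev] with R hR v w h
  have hmix : ∀ v w : Vertex k, v.1 = 0 → w.1 = 1 → shifted x u R v ≠ shifted x u R w := by
    intro v w hv hw he
    rw [shifted_of_side_zero hv, shifted_of_side_one hw] at he
    have := congrArg ℓ he
    rw [map_add, map_smul, hℓ, smul_eq_mul, mul_one] at this
    linarith [hR v w]
  obtain hv | hv := (by omega : v.1 = 0 ∨ v.1 = 1) <;>
    obtain hw | hw := (by omega : w.1 = 0 ∨ w.1 = 1)
  · rw [shifted_of_side_zero hv, shifted_of_side_zero hw] at h
    exact hx.injOn 0 hv hw h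
  · exact absurd h (hmix v w hv hw)
  · exact absurd h.symm (hmix w v hw hv)
  · rw [shifted_of_side_one hv, shifted_of_side_one hw, add_left_inj] at h
    exact hx.injOn 1 hv hw h

/-- Within one side the shift is a translation; only edges of `M_1 * M_2` need `R` large. -/
theorem eventually_affineIndependent_edge (hx : IsSeparated x u) {e : Set (Vertex k)}
    (he : e ∈ (pathHypergraph k).edgeSet) :
    ∀ᶠ R : ℝ in atTop, AffineIndependent ℝ (fun v : e => shifted x u R v) := by
  obtain (he | he) | he := he
  · refine Eventually.of_forall fun R => ?_
    convert hx.indep_K 0 e he using 2 with v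
    exact shifted_of_side_zero (side_of_mem_K he v.2)
  · refine Eventually.of_forall fun R => ?_
    have hind := hx.indep_K 1 e he
    rw [affineIndependent_iff] at hind ⊢
    intro s w hw0 hw
    refine hind s w hw0 ?_
    rw [← hw, ← add_zero (∑ i ∈ s, w i • x i)]
    have : ∑ i ∈ s, w i • shifted x u R i = ∑ i ∈ s, (w i • x i + w i • R • u) :=
      Finset.sum_congr rfl fun v _ => by
        rw [shifted_of_side_one (side_of_mem_K he v.2), smul_add]
    rw [this, Finset.sum_add_distrib, ← Finset.sum_smul, hw0, zero_smul]
  · obtain ⟨S, hS, T, hT, rfl⟩ := mem_join_M_iff.1 he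
    exact hx.indep_M S hS T hT

theorem eventually_convexHull_inter (hx : IsSeparated x u) {e₁ e₂ : Set (Vertex k)}
    (he₁ : e₁ ∈ (pathHypergraph k).edgeSet) (he₂ : e₂ ∈ (pathHypergraph k).edgeSet) :
    ∀ᶠ R : ℝ in atTop,
      convexHull ℝ (shifted x u R '' e₁) ∩ convexHull ℝ (shifted x u R '' e₂) =
        convexHull ℝ (shifted x u R '' e₁ ∩ shifted x u R '' e₂) := by
  have hsep : ∀ {A B : Set (Vertex k)}, (∀ᶠ R : ℝ in atTop, Separable (shifted x u R) A B) →
      ∀ᶠ R : ℝ in atTop,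
      convexHull ℝ (shifted x u R '' A) ∩ convexHull ℝ (shifted x u R '' B) =
        convexHull ℝ (shifted x u R '' A ∩ shifted x u R '' B) := by
    intro A B h
    filter_upwards [h] with R hR
    obtain ⟨a, g, hs⟩ := hR
    exact convexHull_inter_of_separates a g hs
  have hsep' : ∀ {A B : Set (Vertex k)}, (∀ᶠ R : ℝ in atTop, Separable (shifted x u R) A B) →
      ∀ᶠ R : ℝ in atTop,
      convexHull ℝ (shifted x u R '' B) ∩ convexHull ℝ (shifted x u R '' A) =
        convexHull ℝ (shifted x u R '' B ∩ shifted x u R '' A) := by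
    intro A B h
    filter_upwards [hsep h] with R hR
    rw [Set.inter_comm, hR, Set.inter_comm]
  have hsame : ∀ s, e₁ ∈ K k s → e₂ ∈ K k s →
      ∀ᶠ R : ℝ in atTop, Separable (shifted x u R) e₁ e₂ := by
    intro s h₁ h₂
    obtain ⟨a, g, h⟩ := hx.sep_K_K s e₁ h₁ e₂ h₂
    refine Eventually.of_forall fun R => ?_
    obtain ⟨a', h'⟩ := exists_separates_shifted (fun v hv => side_of_mem_K h₁ hv)
      (fun v hv => side_of_mem_K h₂ hv) h R
    exact ⟨a', g, h'⟩
  obtain (h₁ | h₁) | h₁ := he₁ <;> obtain (h₂ | h₂) | h₂ := he₂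
  · exact hsep (hsame 0 h₁ h₂)
  · exact hsep (eventually_separable_K_K hx h₁ h₂)
  · obtain ⟨S, hS, T, hT, rfl⟩ := mem_join_M_iff.1 h₂
    exact hsep (eventually_separable_K_M_zero hx h₁ hS hT)
  · exact hsep' (eventually_separable_K_K hx h₂ h₁)
  · exact hsep (hsame 1 h₁ h₂)
  · obtain ⟨S, hS, T, hT, rfl⟩ := mem_join_M_iff.1 h₂
    exact hsep (eventually_separable_K_M_one hx h₁ hS hT)
  · obtain ⟨S, hS, T, hT, rfl⟩ := mem_join_M_iff.1 h₁
    exact hsep' (eventually_separable_K_M_zero hx h₂ hS hT)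
  · obtain ⟨S, hS, T, hT, rfl⟩ := mem_join_M_iff.1 h₁
    exact hsep' (eventually_separable_K_M_one hx h₂ hS hT)
  · obtain ⟨S, hS, T, hT, rfl⟩ := mem_join_M_iff.1 h₁
    obtain ⟨S', hS', T', hT', rfl⟩ := mem_join_M_iff.1 h₂
    by_cases hne : S ≠ S' ∨ T ≠ T'
    · exact hsep (eventually_separable_M_M hx hS hS' hT hT' hne)
    · push Not at hne
      obtain ⟨rfl, rfl⟩ := hne
      exact Eventually.of_forall fun R => by rw [Set.inter_self, Set.inter_self]

end

/-- There are finitely many conditions, each valid for all large `R`, so a single `R` meets them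
all. -/
theorem geometricallyEmbeddable_of_isSeparated {k d : ℕ} (hk : 1 ≤ k) (hd : d = 2 * k - 1)
    {x : Vertex k → EuclideanSpace ℝ (Fin d)} {u : EuclideanSpace ℝ (Fin d)}
    (hx : IsSeparated x u) : GeometricallyEmbeddable (pathHypergraph k) (d + 1) d := by
  have hdk : d + 1 = 2 * k := by omega
  refine ⟨hdk ▸ isUniform_pathHypergraph k, ?_⟩
  have hind : ∀ᶠ R : ℝ in atTop, ∀ e, e ∈ (pathHypergraph k).edgeSet →
      AffineIndependent ℝ (fun v : e => shifted x u R v) :=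
    eventually_all.2 fun e => eventually_imp_distrib_left.2 fun he =>
      eventually_affineIndependent_edge hx he
  have hinter : ∀ᶠ R : ℝ in atTop, ∀ e₁, e₁ ∈ (pathHypergraph k).edgeSet →
      ∀ e₂, e₂ ∈ (pathHypergraph k).edgeSet →
      convexHull ℝ (shifted x u R '' e₁) ∩ convexHull ℝ (shifted x u R '' e₂) =
        convexHull ℝ (shifted x u R '' e₁ ∩ shifted x u R '' e₂) :=
    eventually_all.2 fun e₁ => eventually_imp_distrib_left.2 fun he₁ =>
      eventually_all.2 fun e₂ => eventually_imp_distrib_left.2 fun he₂ =>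
        eventually_convexHull_inter hx he₁ he₂
  obtain ⟨R, hR, hRi, hRc⟩ := ((eventually_injective_shifted hx).and (hind.and hinter)).exists
  refine ⟨shifted x u R, hR.injOn, fun e he => ?_, hRc⟩
  have hcard := isUniform_pathHypergraph k e he
  rw [← hdk] at hcard
  rw [finrank_direction_affineSpan_image (n := d) (by exact_mod_cast hcard) (hRi e he)]

end GeomHypergraph

/-! ### The moment curve: edges of `K` -/

namespace GeomHypergraph

open Filter Module Polynomial

/-- The point with parameter `t` on the moment curve in `ℝ^n`. -/
noncomputable def momentPoint (n : ℕ) (t : ℝ) : EuclideanSpace ℝ (Fin n) :=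
  WithLp.toLp 2 fun l => t ^ ((l : ℕ) + 1)

/-- The nonconstant coefficients of `F` are the coordinates of the functional; the last basis vector
reads off the coefficient of degree `n`. -/
theorem exists_linear_of_polynomial {n : ℕ} (last : Fin n) (hlast : (last : ℕ) + 1 = n)
    (F : ℝ[X]) (hF : F.natDegree ≤ n) :
    ∃ g : EuclideanSpace ℝ (Fin n) →ₗ[ℝ] ℝ, (∀ t, F.coeff 0 + g (momentPoint n t) = F.eval t) ∧
      g (EuclideanSpace.single last 1) = F.coeff n := by
  refine ⟨∑ l : Fin n, F.coeff (l + 1) • (EuclideanSpace.proj l :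
    EuclideanSpace ℝ (Fin n) →L[ℝ] ℝ).toLinearMap, fun t => ?_, ?_⟩
  · rw [Polynomial.eval_eq_sum_range' (Nat.lt_succ_of_le hF), Finset.sum_range_succ',
      Finset.sum_range]
    simp [momentPoint, add_comm]
  · simp [hlast]

/-- The position of a vertex in the concatenation of all paths on its side. -/
def node {k : ℕ} (v : Vertex k) : ℤ := (v.2.1 : ℕ) * (4 * k - 2 : ℤ) + (v.2.2 : ℕ) + 1

/-- The parameter of a vertex on the moment curve. -/
noncomputable def time {k : ℕ} (v : Vertex k) : ℝ := sideSign v.1 * (node v : ℝ)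

theorem one_le_of_vertex {k : ℕ} (v : Vertex k) : 1 ≤ k := by
  have := v.2.1.2
  omega

theorem node_pos {k : ℕ} (v : Vertex k) : 0 < node v := by
  have := one_le_of_vertex v
  have h : (0 : ℤ) ≤ (v.2.1 : ℕ) * (4 * k - 2 : ℤ) :=
    mul_nonneg (by positivity) (by omega)
  unfold node
  omega

theorem node_lt_of_path_lt {k : ℕ} {v w : Vertex k} (h : v.2.1 < w.2.1) : node v < node w := by
  have hk := one_le_of_vertex v
  have hv := v.2.2.2
  have h1 : ((v.2.1 : ℕ) + 1 : ℤ) * (4 * k - 2) ≤ (w.2.1 : ℕ) * (4 * k - 2) :=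
    mul_le_mul_of_nonneg_right (by exact_mod_cast h) (by omega)
  unfold node
  rw [add_mul, one_mul] at h1
  omega

theorem eq_of_node_eq {k : ℕ} {v w : Vertex k} (hs : v.1 = w.1) (h : node v = node w) :
    v = w := by
  have hi : v.2.1 = w.2.1 := by
    by_contra hne
    rcases lt_or_gt_of_ne hne with hlt | hlt
    · exact absurd h (node_lt_of_path_lt hlt).ne
    · exact absurd h (node_lt_of_path_lt hlt).ne'
  have hj : v.2.2 = w.2.2 := by
    unfold node at h
    rw [hi] at h
    exact Fin.ext (by omega)
  exact Prod.ext hs (Prod.ext hi hj)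

theorem time_injective {k : ℕ} : Function.Injective (time : Vertex k → ℝ) := by
  intro v w h
  have hv : (0 : ℝ) < node v := by exact_mod_cast node_pos v
  have hw : (0 : ℝ) < node w := by exact_mod_cast node_pos w
  unfold time at h
  obtain hsv | hsv := (by omega : v.1 = 0 ∨ v.1 = 1) <;>
    obtain hsw | hsw := (by omega : w.1 = 0 ∨ w.1 = 1) <;>
    simp only [hsv, hsw, sideSign_zero, sideSign_one] at h
  · exact eq_of_node_eq (hsv.trans hsw.symm) (by exact_mod_cast (by linarith : (node v : ℝ) = node w))
  · linarith
  · linarith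
  · exact eq_of_node_eq (hsv.trans hsw.symm) (by exact_mod_cast (by linarith : (node v : ℝ) = node w))

/-- The placement of the vertices on the moment curve, side `0` at positive and side `1` at
negative parameters. -/
noncomputable def momentPlacement (k : ℕ) (v : Vertex k) : EuclideanSpace ℝ (Fin (2 * k - 1)) :=
  momentPoint _ (time v)

section

variable {k : ℕ} {last : Fin (2 * k - 1)}

/-- Side `1` has negative parameters, so `X` is replaced by `-X`; since `2 * k - 1` is odd, the top
coefficient changes sign there. -/
theorem exists_linear_of_polynomial_node (hlast : (last : ℕ) + 1 = 2 * k - 1) (s : Fin 2)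
    (F : ℝ[X]) (hF : F.natDegree ≤ 2 * k - 1) :
    ∃ (a : ℝ) (g : EuclideanSpace ℝ (Fin (2 * k - 1)) →ₗ[ℝ] ℝ),
      (∀ v : Vertex k, v.1 = s → a + g (momentPlacement k v) = F.eval (node v : ℝ)) ∧
      g (EuclideanSpace.single last 1) = sideSign s * F.coeff (2 * k - 1) := by
  obtain rfl | rfl := (by omega : s = 0 ∨ s = 1)
  · obtain ⟨g, hg, hu⟩ := exists_linear_of_polynomial last hlast F hF
    refine ⟨F.coeff 0, g, fun v hv => ?_, by rw [hu, sideSign_zero, one_mul]⟩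
    rw [momentPlacement, hg, time, hv, sideSign_zero, one_mul]
  · obtain ⟨g, hg, hu⟩ := exists_linear_of_polynomial last hlast (F.comp (C (-1) * X)) (by
      rw [natDegree_comp, natDegree_C_mul_X _ (by norm_num), mul_one]; exact hF)
    refine ⟨(F.comp (C (-1) * X)).coeff 0, g, fun v hv => ?_, ?_⟩
    · rw [momentPlacement, hg, time, hv, sideSign_one]
      simp
    · have hodd : Odd (2 * k - 1) := ⟨last / 2, by omega⟩
      rw [hu, comp_C_mul_X_coeff, hodd.neg_one_pow, sideSign_one, mul_comm]

/-- The polynomial with simple zeros exactly at the nodes of a hyperedge of `K`; it is nonnegative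
at all integers because the nodes come in consecutive pairs. -/
theorem exists_polynomial_of_mem_K {s : Fin 2} {A : Set (Vertex k)} (hA : A ∈ K k s) :
    ∃ G : ℝ[X], G.Monic ∧ G.natDegree = 2 * k ∧ (∀ m : ℤ, 0 ≤ G.eval (m : ℝ)) ∧
      ∀ v : Vertex k, v.1 = s → (G.eval (node v : ℝ) = 0 ↔ v ∈ A) := by
  obtain ⟨i, a, b, -, hab, rfl⟩ := mem_K_iff.1 hA
  refine ⟨∏ t, ((X - C (node (s, i t, a t) : ℝ)) * (X - C (node (s, i t, b t) : ℝ))), ?_, ?_, ?_,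
    ?_⟩
  · exact monic_prod_of_monic _ _ fun t _ => (monic_X_sub_C _).mul (monic_X_sub_C _)
  · rw [natDegree_prod_of_monic _ _ fun t _ => (monic_X_sub_C _).mul (monic_X_sub_C _)]
    rw [Finset.sum_congr rfl fun t _ => (monic_X_sub_C _).natDegree_mul (monic_X_sub_C _)]
    simp only [natDegree_X_sub_C, Finset.sum_const, Finset.card_univ, Fintype.card_fin,
      smul_eq_mul]
    ring
  · intro m
    rw [eval_prod]
    refine Finset.prod_nonneg fun t _ => ?_
    have hnode : node (s, i t, b t) = node (s, i t, a t) + 1 := by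
      have := hab t
      simp only [node]
      omega
    rw [hnode]
    simp only [eval_mul, eval_sub, eval_X, eval_C]
    have hint : 0 ≤ (m - node (s, i t, a t)) * (m - (node (s, i t, a t) + 1)) := by
      rcases le_or_gt m (node (s, i t, a t)) with h | h
      · exact mul_nonneg_of_nonpos_of_nonpos (by omega) (by omega)
      · exact mul_nonneg (by omega) (by omega)
    exact_mod_cast hint
  · intro v hv
    rw [eval_prod, Finset.prod_eq_zero_iff]
    simp only [Finset.mem_univ, true_and, eval_mul, eval_sub, eval_X, eval_C, mul_eq_zero,
      sub_eq_zero, Int.cast_inj, Set.mem_ofPred_eq]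
    refine exists_congr fun t => or_congr ?_ ?_
    · exact ⟨fun h => eq_of_node_eq hv h, fun h => by rw [h]⟩
    · exact ⟨fun h => eq_of_node_eq hv h, fun h => by rw [h]⟩

/-- The monic polynomials `P` and `Q` of degree `2 * k` lose their leading terms in `Q - P`, which
is therefore an admissible functional. It equals `Q ≥ 0` on `A` and `-P ≤ 0` on `B`. -/
theorem momentPlacement_sep_K_K (hlast : (last : ℕ) + 1 = 2 * k - 1) {s : Fin 2}
    {A B : Set (Vertex k)} (hA : A ∈ K k s) (hB : B ∈ K k s) :
    ∃ (a : ℝ) (g : EuclideanSpace ℝ (Fin (2 * k - 1)) →ₗ[ℝ] ℝ),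
      Separates (fun v => a + g (momentPlacement k v)) A B := by
  obtain ⟨P, hPm, hPd, hP0, hPz⟩ := exists_polynomial_of_mem_K hA
  obtain ⟨Q, hQm, hQd, hQ0, hQz⟩ := exists_polynomial_of_mem_K hB
  have hdeg : (Q - P).natDegree ≤ 2 * k - 1 := by
    have h1 : (Q - P).degree < Q.degree :=
      degree_sub_lt_left (by rw [degree_eq_natDegree hQm.ne_zero, degree_eq_natDegree hPm.ne_zero,
        hQd, hPd]) hQm.ne_zero (by rw [hQm.leadingCoeff, hPm.leadingCoeff])
    rw [degree_eq_natDegree hQm.ne_zero, hQd] at h1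
    by_cases h0 : Q - P = 0
    · simp [h0]
    · have := (natDegree_lt_iff_degree_lt h0).2 h1
      omega
  obtain ⟨a, g, hg, -⟩ := exists_linear_of_polynomial_node hlast s (Q - P) hdeg
  have hval : ∀ v, v.1 = s → a + g (momentPlacement k v) =
      Q.eval (node v : ℝ) - P.eval (node v : ℝ) := fun v hv => by rw [hg v hv, eval_sub]
  refine ⟨a, g, fun v hv => ?_, fun v hv => ?_, fun v hv h0 => ?_⟩
  · beta_reduce
    rw [hval v (side_of_mem_K hA hv), (hPz v (side_of_mem_K hA hv)).2 hv, sub_zero]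
    exact hQ0 _
  · beta_reduce
    rw [hval v (side_of_mem_K hB hv), (hQz v (side_of_mem_K hB hv)).2 hv, zero_sub, neg_nonpos]
    exact hP0 _
  · beta_reduce at h0
    rw [hval v (side_of_mem_K hA hv), (hPz v (side_of_mem_K hA hv)).2 hv, sub_zero] at h0
    exact (hQz v (side_of_mem_K hA hv)).1 h0

/-- Removing one point leaves `2 * k - 1` parameters, the roots of a polynomial of admissible degree
that is nonzero at the removed one. -/
theorem momentPlacement_affineIndependent (hlast : (last : ℕ) + 1 = 2 * k - 1)
    {A : Set (Vertex k)} (hA : A.encard = (2 * k : ℕ)) :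
    AffineIndependent ℝ (fun v : A => momentPlacement k v) := by
  classical
  refine affineIndependent_of_isolating fun v hv => ?_
  set Z := (A.toFinite.toFinset).erase v
  have hcard : Z.card = 2 * k - 1 := by
    rw [Finset.card_erase_of_mem (by simpa using hv)]
    have := A.toFinite.encard_eq_coe_toFinset_card
    rw [hA] at this
    have h2 : 2 * k = A.toFinite.toFinset.card := by exact_mod_cast this
    omega
  have hdeg : (∏ w ∈ Z, (X - C (time w))).natDegree ≤ 2 * k - 1 := by
    rw [natDegree_finsetProd_X_sub_C_eq_card, hcard]
  obtain ⟨g, hg, -⟩ := exists_linear_of_polynomial last hlast _ hdeg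
  refine ⟨(∏ w ∈ Z, (X - C (time w))).coeff 0, g, ?_, fun w hw hne => ?_⟩
  · rw [momentPlacement, hg, eval_prod, Finset.prod_ne_zero_iff]
    intro w hw
    simp only [eval_sub, eval_X, eval_C, sub_ne_zero]
    exact fun he => Finset.ne_of_mem_erase hw (time_injective he).symm
  · rw [momentPlacement, hg, eval_prod]
    refine Finset.prod_eq_zero (i := w) ?_ (by simp)
    exact Finset.mem_erase.2 ⟨hne, by simpa using hw⟩

end

end GeomHypergraph

/-! ### The moment curve: edges of `K` against matching sets -/

namespace GeomHypergraph

open Filter Module Polynomial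

section

variable {k : ℕ} {last : Fin (2 * k - 1)}

/-- The nodes of a half lie in a block of `2 * k - 1` consecutive integers and are the integers of
that block with the parity of its first element. -/
theorem mem_half_iff_node {s : Fin 2} {i : Fin (2 * k - 1)} {h : Fin 2} {v : Vertex k}
    (hv : v.1 = s) :
    v ∈ half k s i h ↔ (2 * (i : ℕ) + (h : ℕ) : ℤ) * (2 * k - 1) + 1 ≤ node v ∧
      node v ≤ (2 * (i : ℕ) + (h : ℕ) : ℤ) * (2 * k - 1) + (2 * k - 1) ∧
      (node v - ((2 * (i : ℕ) + (h : ℕ) : ℤ) * (2 * k - 1) + 1)) % 2 = 0 := by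
  have hk := one_le_of_vertex v
  have hexp : (2 * (i : ℕ) + (h : ℕ) : ℤ) * (2 * k - 1) =
      (i : ℕ) * (4 * k - 2 : ℤ) + (h : ℕ) * (2 * k - 1) := by ring
  rw [hexp]
  have hj := v.2.2.2
  have hh : ((h : ℕ) : ℤ) * (2 * k - 1) = ((h * (2 * k - 1) : ℕ) : ℤ) := by
    rw [Nat.cast_mul, Nat.cast_sub (by omega)]
    push_cast
    ring
  have hhle : (h : ℕ) * (2 * k - 1) ≤ 2 * k - 1 := by
    obtain rfl | rfl := (by omega : h = 0 ∨ h = 1) <;> simp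
  rw [hh]
  simp only [half, Set.mem_ofPred_eq, hv, true_and]
  constructor
  · rintro ⟨hi, m, hm, hj⟩
    unfold node
    rw [hi]
    omega
  · rintro ⟨h1, h2, h3⟩
    have hi : v.2.1 = i := by
      by_contra hne
      rcases lt_or_gt_of_ne hne with hlt | hlt
      · have : ((v.2.1 : ℕ) + 1 : ℤ) * (4 * k - 2) ≤ (i : ℕ) * (4 * k - 2) :=
          mul_le_mul_of_nonneg_right (by exact_mod_cast hlt) (by omega)
        rw [add_mul, one_mul] at this
        unfold node at h1
        omega
      · have : ((i : ℕ) + 1 : ℤ) * (4 * k - 2) ≤ (v.2.1 : ℕ) * (4 * k - 2) :=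
          mul_le_mul_of_nonneg_right (by exact_mod_cast hlt) (by omega)
        rw [add_mul, one_mul] at this
        unfold node at h2
        omega
    unfold node at h1 h2 h3
    rw [hi] at h1 h2 h3
    refine ⟨hi, ((v.2.2 : ℕ) - h * (2 * k - 1)) / 2, ?_, ?_⟩ <;> omega

/-- Vertices on other paths have nodes outside the block of a half. -/
theorem node_outside_of_path_ne {i : Fin (2 * k - 1)} (h : Fin 2) {v : Vertex k}
    (hv : v.2.1 ≠ i) :
    node v < (2 * (i : ℕ) + (h : ℕ) : ℤ) * (2 * k - 1) + 1 ∨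
      (2 * (i : ℕ) + (h : ℕ) : ℤ) * (2 * k - 1) + (2 * k - 1) < node v := by
  have hk := one_le_of_vertex v
  have hexp : (2 * (i : ℕ) + (h : ℕ) : ℤ) * (2 * k - 1) =
      (i : ℕ) * (4 * k - 2 : ℤ) + (h : ℕ) * (2 * k - 1) := by ring
  have hj := v.2.2.2
  have hh0 : (0 : ℤ) ≤ (h : ℕ) * (2 * k - 1) := mul_nonneg (by omega) (by omega)
  have hh1 : ((h : ℕ) : ℤ) * (2 * k - 1) ≤ 2 * k - 1 := by
    obtain rfl | rfl := (by omega : h = 0 ∨ h = 1) <;> simp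
    omega
  rw [hexp]
  unfold node
  rcases lt_or_gt_of_ne hv with hlt | hlt
  · have : ((v.2.1 : ℕ) + 1 : ℤ) * (4 * k - 2) ≤ (i : ℕ) * (4 * k - 2) :=
      mul_le_mul_of_nonneg_right (by exact_mod_cast hlt) (by omega)
    rw [add_mul, one_mul] at this
    omega
  · have : ((i : ℕ) + 1 : ℤ) * (4 * k - 2) ≤ (v.2.1 : ℕ) * (4 * k - 2) :=
      mul_le_mul_of_nonneg_right (by exact_mod_cast hlt) (by omega)
    rw [add_mul, one_mul] at this
    omega

/-- Half-integers `a / 2 ≤ b / 2 ≤ c / 2 ≤ e / 2` separating the integers of one parity in the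
block `[l, r]` from the integers outside the block and a further pair `p, p + 1`. The two sets
share at most the point `z / 2`. -/
theorem exists_interlacing_roots (l r p : ℤ) (hlr : l ≤ r) (hpar : (r - l) % 2 = 0) :
    ∃ a b c e z : ℤ, a ≤ b ∧ b ≤ c ∧ c ≤ e ∧ (z = a ∨ z = b ∨ z = c ∨ z = e) ∧
      (∀ t : ℤ, (t < l ∨ r < t ∨ t = p ∨ t = p + 1) →
        (2 * t = z ∧ l ≤ t ∧ t ≤ r ∧ (t - l) % 2 = 0) ∨
          2 * t < a ∨ (b < 2 * t ∧ 2 * t < c) ∨ e < 2 * t) ∧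
      ∀ t : ℤ, l ≤ t → t ≤ r → (t - l) % 2 = 0 →
        2 * t = z ∨ (a < 2 * t ∧ 2 * t < b) ∨ (c < 2 * t ∧ 2 * t < e) := by
  -- While the pair is not inside the block, three roots coincide and the sign pattern is that of a
  -- quadratic. If the pair misses the block, `z` is odd and thus never equals `2 * t`.
  by_cases h1 : p + 1 < l ∨ r < p
  · exact ⟨2 * l - 1, 2 * r + 1, 2 * r + 1, 2 * r + 1, 2 * l - 1, by omega, by omega, by omega,
      by omega, fun t ht => by omega, fun t _ _ _ => by omega⟩
  by_cases h2 : p + 1 = l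
  · exact ⟨2 * l, 2 * r + 1, 2 * r + 1, 2 * r + 1, 2 * l, by omega, by omega, by omega,
      by omega, fun t ht => by omega, fun t _ _ _ => by omega⟩
  by_cases h3 : p = r
  · exact ⟨2 * l - 1, 2 * r, 2 * r, 2 * r, 2 * r, by omega, by omega, by omega,
      by omega, fun t ht => by omega, fun t _ _ _ => by omega⟩
  -- The pair now lies inside the block: its member of the right parity is the common root `z / 2`,
  -- the other one falls in the gap between the two middle roots.
  by_cases h4 : (p - l) % 2 = 0
  · exact ⟨2 * l - 1, 2 * p, 2 * p + 3, 2 * r + 1, 2 * p, by omega, by omega, by omega,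
      by omega, fun t ht => by omega, fun t _ _ _ => by omega⟩
  · exact ⟨2 * l - 1, 2 * p - 1, 2 * p + 2, 2 * r + 1, 2 * p + 2, by omega, by omega, by omega,
      by omega, fun t ht => by omega, fun t _ _ _ => by omega⟩

/-- An edge visits each path at most once, and then in two consecutive vertices. -/
theorem exists_pair_of_mem_K {s : Fin 2} {A : Set (Vertex k)} (hA : A ∈ K k s)
    (i : Fin (2 * k - 1)) (h : Fin 2) :
    ∃ p : ℤ, ∀ v ∈ A, node v < (2 * (i : ℕ) + (h : ℕ) : ℤ) * (2 * k - 1) + 1 ∨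
      (2 * (i : ℕ) + (h : ℕ) : ℤ) * (2 * k - 1) + (2 * k - 1) < node v ∨
      node v = p ∨ node v = p + 1 := by
  obtain ⟨ι, a, b, hι, hab, rfl⟩ := mem_K_iff.1 hA
  by_cases ht : ∃ t, ι t = i
  · obtain ⟨t, rfl⟩ := ht
    refine ⟨node (s, ι t, a t), ?_⟩
    rintro v ⟨t', hv⟩
    by_cases htt : t' = t
    · subst htt
      have := hab t'
      obtain rfl | rfl := hv
      · exact Or.inr (Or.inr (Or.inl rfl))
      · refine Or.inr (Or.inr (Or.inr ?_))
        simp only [node]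
        omega
    · have hne : v.2.1 ≠ ι t := by
        obtain rfl | rfl := hv <;> exact fun he => htt (hι.injective he)
      exact (node_outside_of_path_ne h hne).imp_right Or.inl
  -- The edge avoids path `i`, so the value of `p` is irrelevant.
  · refine ⟨0, ?_⟩
    rintro v ⟨t', hv⟩
    have hne : v.2.1 ≠ i := by
      obtain rfl | rfl := hv <;> exact fun he => ht ⟨t', he⟩
    exact (node_outside_of_path_ne h hne).imp_right Or.inl

theorem quartic_pos {a b c e t : ℝ} (hab : a ≤ b) (hbc : b ≤ c) (hce : c ≤ e)
    (h : t < a ∨ (b < t ∧ t < c) ∨ e < t) : 0 < (t - a) * (t - b) * ((t - c) * (t - e)) := by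
  rcases h with h | ⟨h, h'⟩ | h
  · exact mul_pos (mul_pos_of_neg_of_neg (by linarith) (by linarith))
      (mul_pos_of_neg_of_neg (by linarith) (by linarith))
  · exact mul_pos (mul_pos (by linarith) (by linarith))
      (mul_pos_of_neg_of_neg (by linarith) (by linarith))
  · exact mul_pos (mul_pos (by linarith) (by linarith)) (mul_pos (by linarith) (by linarith))

theorem quartic_neg {a b c e t : ℝ} (hab : a ≤ b) (hbc : b ≤ c) (hce : c ≤ e)
    (h : (a < t ∧ t < b) ∨ (c < t ∧ t < e)) : (t - a) * (t - b) * ((t - c) * (t - e)) < 0 := by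
  rcases h with ⟨h, h'⟩ | ⟨h, h'⟩
  · exact mul_neg_of_neg_of_pos (mul_neg_of_pos_of_neg (by linarith) (by linarith))
      (mul_pos_of_neg_of_neg (by linarith) (by linarith))
  · exact mul_neg_of_pos_of_neg (mul_pos (by linarith) (by linarith))
      (mul_neg_of_pos_of_neg (by linarith) (by linarith))

/-- A quartic with the required signs. -/
theorem exists_quartic (hk : 1 ≤ k) {s : Fin 2} {A S : Set (Vertex k)} (hA : A ∈ K k s)
    (hS : S ∈ M k s) :
    ∃ (F : ℝ[X]) (z : ℝ), F.natDegree ≤ 4 ∧ F.eval z = 0 ∧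
      (∀ v ∈ A, (node v = z ∧ v ∈ S) ∨ 0 < F.eval (node v : ℝ)) ∧
      ∀ v ∈ S, (node v : ℝ) = z ∨ F.eval (node v : ℝ) < 0 := by
  obtain ⟨i, h, rfl⟩ := mem_M_iff.1 hS
  obtain ⟨p, hp⟩ := exists_pair_of_mem_K hA i h
  have hblock : ∀ v : Vertex k, v.1 = s → (v ∈ half k s i h ↔ _) :=
    fun v hv => mem_half_iff_node hv
  generalize (2 * (i : ℕ) + (h : ℕ) : ℤ) * (2 * k - 1) = q at hp hblock
  obtain ⟨a, b, c, e, z, hab, hbc, hce, hz, hpos, hneg⟩ :=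
    exists_interlacing_roots (q + 1) (q + (2 * k - 1)) p (by omega) (by omega)
  have hab' : (a : ℝ) / 2 ≤ b / 2 := by
    have : (a : ℝ) ≤ b := by exact_mod_cast hab
    linarith
  have hbc' : (b : ℝ) / 2 ≤ c / 2 := by
    have : (b : ℝ) ≤ c := by exact_mod_cast hbc
    linarith
  have hce' : (c : ℝ) / 2 ≤ e / 2 := by
    have : (c : ℝ) ≤ e := by exact_mod_cast hce
    linarith
  have hlt : ∀ t n : ℤ, 2 * t < n → (t : ℝ) < n / 2 := by
    intro t n htn
    have : (2 * t : ℝ) < n := by exact_mod_cast htn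
    linarith
  have hgt : ∀ t n : ℤ, n < 2 * t → (n : ℝ) / 2 < t := by
    intro t n htn
    have : (n : ℝ) < 2 * t := by exact_mod_cast htn
    linarith
  have heq : ∀ t n : ℤ, 2 * t = n → (t : ℝ) = n / 2 := by
    rintro t n rfl
    push_cast
    ring
  have heval : ∀ t : ℝ, ((X - C (a / 2 : ℝ)) * (X - C (b / 2 : ℝ)) *
      ((X - C (c / 2 : ℝ)) * (X - C (e / 2 : ℝ)))).eval t =
      (t - a / 2) * (t - b / 2) * ((t - c / 2) * (t - e / 2)) := by
    intro t
    simp only [eval_mul, eval_sub, eval_X, eval_C]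
  refine ⟨(X - C (a / 2 : ℝ)) * (X - C (b / 2 : ℝ)) *
    ((X - C (c / 2 : ℝ)) * (X - C (e / 2 : ℝ))), z / 2, ?_, ?_, fun v hv => ?_, fun v hv => ?_⟩
  · refine natDegree_mul_le.trans (add_le_add (natDegree_mul_le.trans ?_)
      (natDegree_mul_le.trans ?_) : _ ≤ 2 + 2) <;> simp
  · rw [heval]
    rcases hz with rfl | rfl | rfl | rfl <;> simp
  · rcases hpos (node v) (by have := hp v hv; omega) with ⟨h1, h2, h3, h4⟩ | h1
    · exact Or.inl ⟨heq _ _ h1, (hblock v (side_of_mem_K hA hv)).2 ⟨h2, h3, h4⟩⟩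
    · rw [heval]
      exact Or.inr (quartic_pos hab' hbc' hce'
        (h1.imp (hlt _ _) (Or.imp (And.imp (hgt _ _) (hlt _ _)) (hgt _ _))))
  · obtain ⟨h1, h2, h3⟩ := (hblock v hv.1).1 hv
    rcases hneg (node v) h1 h2 h3 with h1 | h1
    · exact Or.inl (heq _ _ h1)
    · rw [heval]
      exact Or.inr (quartic_neg hab' hbc' hce'
        (h1.imp (And.imp (hgt _ _) (hlt _ _)) (And.imp (hgt _ _) (hlt _ _))))

/-- For `k ≥ 3` the quartic has degree below `2 * k - 1`. Subtracting a small multiple of a monic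
polynomial of full degree makes the top coefficient negative; that polynomial also vanishes at `z`,
so a shared vertex stays a zero. -/
theorem momentPlacement_sep_K_M (hk : 3 ≤ k) (hlast : (last : ℕ) + 1 = 2 * k - 1) {s : Fin 2}
    {A S : Set (Vertex k)} (hA : A ∈ K k s) (hS : S ∈ M k s) :
    ∃ (a : ℝ) (g : EuclideanSpace ℝ (Fin (2 * k - 1)) →ₗ[ℝ] ℝ),
      sideSign s * g (EuclideanSpace.single last 1) < 0 ∧
      Separates (fun v => a + g (momentPlacement k v)) A S := by
  obtain ⟨F, z, hFd, hFz, hFA, hFS⟩ := exists_quartic (by omega) hA hS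
  set Q : ℝ[X] := (X - C z) * X ^ (2 * k - 2) with hQ
  have hQm : Q.Monic := (monic_X_sub_C z).mul (monic_X_pow _)
  have hQd : Q.natDegree = 2 * k - 1 := by
    rw [hQ, (monic_X_sub_C z).natDegree_mul (monic_X_pow _), natDegree_X_sub_C, natDegree_X_pow]
    omega
  have hQz : Q.eval z = 0 := by simp [hQ]
  have hev : ∀ᶠ R : ℝ in atTop, ∀ v : Vertex k,
      (0 < F.eval (node v : ℝ) → 0 < F.eval (node v : ℝ) - Q.eval (node v : ℝ) / R) ∧
      (F.eval (node v : ℝ) < 0 → F.eval (node v : ℝ) - Q.eval (node v : ℝ) / R < 0) := by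
    refine eventually_all.2 fun v => Eventually.and ?_ ?_
    · refine eventually_imp_distrib_left.2 fun hp => ?_
      filter_upwards [eventually_pos_add_div hp (-Q.eval (node v : ℝ))] with R hR
      rw [neg_div] at hR
      linarith
    · refine eventually_imp_distrib_left.2 fun hp => ?_
      filter_upwards [eventually_pos_add_div (neg_pos.2 hp) (Q.eval (node v : ℝ))] with R hR
      linarith
  obtain ⟨R, hR, hR0⟩ := (hev.and (eventually_gt_atTop 0)).exists
  have hdeg : (F - C R⁻¹ * Q).natDegree ≤ 2 * k - 1 := by
    refine (natDegree_sub_le _ _).trans (max_le (by omega) ?_)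
    exact (natDegree_C_mul_le _ _).trans hQd.le
  obtain ⟨a, g, hg, hu⟩ := exists_linear_of_polynomial_node hlast s _ hdeg
  have hcoeff : (F - C R⁻¹ * Q).coeff (2 * k - 1) = -R⁻¹ := by
    rw [coeff_sub, coeff_C_mul, coeff_eq_zero_of_natDegree_lt (by omega : F.natDegree < _), ← hQd,
      hQm.coeff_natDegree]
    ring
  have hval : ∀ v, v.1 = s → a + g (momentPlacement k v) =
      F.eval (node v : ℝ) - Q.eval (node v : ℝ) / R := by
    intro v hv
    rw [hg v hv, eval_sub, eval_C_mul]
    ring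
  have hzero : ∀ v : Vertex k, (node v : ℝ) = z →
      F.eval (node v : ℝ) - Q.eval (node v : ℝ) / R = 0 := by
    intro v hv
    rw [hv, hFz, hQz]
    simp
  refine ⟨a, g, ?_, fun v hv => ?_, fun v hv => ?_, fun v hv h0 => ?_⟩
  · rw [hu, hcoeff]
    have : 0 < R⁻¹ := inv_pos.2 hR0
    obtain rfl | rfl := (by omega : s = 0 ∨ s = 1) <;> simp [hR0]
  · beta_reduce
    rw [hval v (side_of_mem_K hA hv)]
    rcases hFA v hv with ⟨h, -⟩ | h
    · exact (hzero v h).ge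
    · exact ((hR v).1 h).le
  · beta_reduce
    rw [hval v (side_of_mem_M hS hv)]
    rcases hFS v hv with h | h
    · exact (hzero v h).le
    · exact ((hR v).2 h).le
  · beta_reduce at h0
    rw [hval v (side_of_mem_K hA hv)] at h0
    rcases hFA v hv with ⟨-, h⟩ | h
    · exact h
    · exact absurd h0 ((hR v).1 h).ne'

end

end GeomHypergraph

/-! ### The moment curve: matching sets against each other -/

namespace GeomHypergraph

open Filter Module Polynomial

section

variable {k : ℕ} {last : Fin (2 * k - 1)}

theorem nonempty_of_mem_M (hk : 1 ≤ k) {s : Fin 2} {S : Set (Vertex k)} (hS : S ∈ M k s) :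
    S.Nonempty := by
  rw [← Set.encard_ne_zero, encard_of_mem_M hS]
  exact_mod_cast (by omega : k ≠ 0)

/-- Halves lie in disjoint blocks of consecutive integers, numbered by `2 * i + h`. -/
theorem node_lt_or_lt_of_mem_M {s : Fin 2} {S S' : Set (Vertex k)} (hS : S ∈ M k s)
    (hS' : S' ∈ M k s) (hne : S ≠ S') :
    (∀ v ∈ S, ∀ w ∈ S', node w < node v) ∨ ∀ v ∈ S, ∀ w ∈ S', node v < node w := by
  obtain ⟨i, h, rfl⟩ := mem_M_iff.1 hS
  obtain ⟨i', h', rfl⟩ := mem_M_iff.1 hS'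
  have hih : (2 * (i : ℕ) + (h : ℕ) : ℤ) ≠ 2 * (i' : ℕ) + (h' : ℕ) := by
    intro he
    have h1 : i = i' := Fin.ext (by omega)
    have h2 : h = h' := Fin.ext (by omega)
    exact hne (by rw [h1, h2])
  have key : ∀ (i i' : Fin (2 * k - 1)) (h h' : Fin 2),
      (2 * (i : ℕ) + (h : ℕ) : ℤ) < 2 * (i' : ℕ) + (h' : ℕ) →
      ∀ v ∈ half k s i h, ∀ w ∈ half k s i' h', node v < node w := by
    intro i i' h h' hlt v hv w hw
    have hk := one_le_of_vertex v
    have h1 := ((mem_half_iff_node hv.1).1 hv).2.1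
    have h2 := ((mem_half_iff_node hw.1).1 hw).1
    have h3 : (2 * (i : ℕ) + (h : ℕ) + 1 : ℤ) * (2 * k - 1) ≤
        (2 * (i' : ℕ) + (h' : ℕ)) * (2 * k - 1) :=
      mul_le_mul_of_nonneg_right (by omega) (by omega)
    rw [add_mul, one_mul] at h3
    omega
  rcases lt_or_gt_of_ne hih with hlt | hlt
  · exact Or.inr (key _ _ _ _ hlt)
  · exact Or.inl fun v hv w hw => key _ _ _ _ hlt w hw v hv

theorem exists_strictlySeparates {f : Vertex k → ℝ} {S S' : Set (Vertex k)}
    (h : ∀ v ∈ S, ∀ w ∈ S', f w < f v) :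
    ∃ a : ℝ, StrictlySeparates (fun v => a + f v) S S' := by
  obtain ⟨m, hm, hm'⟩ := Order.exists_between_finsets (S'.toFinite.image f).toFinset
    (S.toFinite.image f).toFinset (by
      intro p hp q hq
      obtain ⟨w, hw, rfl⟩ := (Set.Finite.mem_toFinset _).1 hp
      obtain ⟨v, hv, rfl⟩ := (Set.Finite.mem_toFinset _).1 hq
      exact h v hv w hw)
  refine ⟨-m, fun v hv => ?_, fun v hv => ?_⟩
  · have := hm' (f v) ((Set.Finite.mem_toFinset _).2 ⟨v, hv, rfl⟩)
    beta_reduce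
    linarith
  · have := hm (f v) ((Set.Finite.mem_toFinset _).2 ⟨v, hv, rfl⟩)
    beta_reduce
    linarith

/-- A linear functional vanishing on the last coordinate that is monotone along both sides in
prescribed directions. -/
theorem exists_monotone_functional (hk : 3 ≤ k) (hlast : (last : ℕ) + 1 = 2 * k - 1)
    (σ τ : ℝ) (hσ : σ = 1 ∨ σ = -1) (hτ : τ = 1 ∨ τ = -1) :
    ∃ g : EuclideanSpace ℝ (Fin (2 * k - 1)) →ₗ[ℝ] ℝ, g (EuclideanSpace.single last 1) = 0 ∧
      ∀ v w : Vertex k, v.1 = w.1 → node v < node w →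
        (v.1 = 0 → σ * g (momentPlacement k v) < σ * g (momentPlacement k w)) ∧
        (v.1 = 1 → τ * g (momentPlacement k v) < τ * g (momentPlacement k w)) := by
  have hmono : ∀ (c : ℝ) (n : ℕ), n ≤ 2 → 1 ≤ n →
      ∃ g : EuclideanSpace ℝ (Fin (2 * k - 1)) →ₗ[ℝ] ℝ,
        g (EuclideanSpace.single last 1) = 0 ∧
        ∀ v : Vertex k, g (momentPlacement k v) = c * time v ^ n := by
    intro c n hn hn1
    have hd := natDegree_C_mul_X_pow_le c n
    obtain ⟨g, hg, hu⟩ := exists_linear_of_polynomial last hlast (C c * X ^ n) (by omega)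
    refine ⟨g, ?_, fun v => ?_⟩
    · rw [hu, coeff_eq_zero_of_natDegree_lt (by omega)]
    · have := hg (time v)
      rw [coeff_C_mul_X_pow, if_neg (by omega), zero_add] at this
      rw [momentPlacement, this]
      simp
  have hpos : ∀ v : Vertex k, (0 : ℝ) < node v := fun v => by exact_mod_cast node_pos v
  -- Equal signs call for `± t ^ 2`, since `t ^ 2` increases with the node on both sides; opposite
  -- signs call for `± t`, which is monotone in opposite directions.
  rcases hσ with rfl | rfl <;> rcases hτ with rfl | rfl
  · obtain ⟨g, hg, hv⟩ := hmono 1 2 le_rfl (by norm_num)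
    refine ⟨g, hg, fun v w hvw hlt => ⟨fun h => ?_, fun h => ?_⟩⟩ <;>
    · have hlt' : (node v : ℝ) < node w := by exact_mod_cast hlt
      simp only [hv, time, ← hvw, h, sideSign_zero, sideSign_one]
      nlinarith [hpos v]
  · obtain ⟨g, hg, hv⟩ := hmono 1 1 (by norm_num) le_rfl
    refine ⟨g, hg, fun v w hvw hlt => ⟨fun h => ?_, fun h => ?_⟩⟩ <;>
    · have hlt' : (node v : ℝ) < node w := by exact_mod_cast hlt
      simp only [hv, time, ← hvw, h, sideSign_zero, sideSign_one]
      linarith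
  · obtain ⟨g, hg, hv⟩ := hmono (-1) 1 (by norm_num) le_rfl
    refine ⟨g, hg, fun v w hvw hlt => ⟨fun h => ?_, fun h => ?_⟩⟩ <;>
    · have hlt' : (node v : ℝ) < node w := by exact_mod_cast hlt
      simp only [hv, time, ← hvw, h, sideSign_zero, sideSign_one]
      linarith
  · obtain ⟨g, hg, hv⟩ := hmono (-1) 2 le_rfl (by norm_num)
    refine ⟨g, hg, fun v w hvw hlt => ⟨fun h => ?_, fun h => ?_⟩⟩ <;>
    · have hlt' : (node v : ℝ) < node w := by exact_mod_cast hlt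
      simp only [hv, time, ← hvw, h, sideSign_zero, sideSign_one]
      nlinarith [hpos v]

/-- A functional that vanishes on one member of `M` and is monotone along the other side. -/
theorem exists_vanishing_monotone_functional (hk : 3 ≤ k)
    (hlast : (last : ℕ) + 1 = 2 * k - 1) {s : Fin 2} {S : Set (Vertex k)} (hS : S ∈ M k s) :
    ∃ (a : ℝ) (g : EuclideanSpace ℝ (Fin (2 * k - 1)) →ₗ[ℝ] ℝ),
      g (EuclideanSpace.single last 1) = 0 ∧ (∀ v ∈ S, a + g (momentPlacement k v) = 0) ∧
      ∀ v w : Vertex k, v.1 ≠ s → w.1 ≠ s → node v < node w →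
        g (momentPlacement k v) < g (momentPlacement k w) := by
  have hcard : S.toFinite.toFinset.card = k := by
    have := S.toFinite.encard_eq_coe_toFinset_card
    rw [encard_of_mem_M hS] at this
    exact_mod_cast this.symm
  have hpos : ∀ v : Vertex k, (0 : ℝ) < node v := fun v => by exact_mod_cast node_pos v
  -- The roots are the parameters of `S`, and the signs are normalised so that on the other side
  -- every factor is a sum of two positive nodes.
  set F : ℝ[X] := ∏ v ∈ S.toFinite.toFinset, (C (node v : ℝ) - C (sideSign s) * X) with hF
  have hd : F.natDegree ≤ k := by
    refine (natDegree_prod_le _ _).trans ?_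
    refine (Finset.sum_le_card_nsmul _ _ 1 fun v _ => ?_).trans (by rw [hcard, smul_eq_mul, mul_one])
    refine (natDegree_sub_le _ _).trans (max_le (by simp) ?_)
    exact (natDegree_C_mul_le _ _).trans natDegree_X_le
  have hsq : sideSign s * sideSign s = 1 := by
    obtain rfl | rfl := (by omega : s = 0 ∨ s = 1) <;> simp
  obtain ⟨g, hg, hu⟩ := exists_linear_of_polynomial last hlast F (by omega)
  have hother : ∀ v : Vertex k, v.1 ≠ s →
      F.eval (time v) = ∏ w ∈ S.toFinite.toFinset, ((node w : ℝ) + node v) := by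
    intro v hv
    rw [hF, eval_prod]
    refine Finset.prod_congr rfl fun w _ => ?_
    have : sideSign s * sideSign v.1 = -1 := by
      obtain rfl | rfl := (by omega : s = 0 ∨ s = 1)
      · rw [(by omega : v.1 = 1)]
        simp
      · rw [(by omega : v.1 = 0)]
        simp
    simp only [eval_sub, eval_C, eval_mul, eval_X, time]
    rw [← mul_assoc, this]
    ring
  refine ⟨F.coeff 0, g, ?_, fun v hv => ?_, fun v w hv hw hlt => ?_⟩
  · rw [hu, coeff_eq_zero_of_natDegree_lt (by omega)]
  · rw [momentPlacement, hg, hF, eval_prod]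
    refine Finset.prod_eq_zero (i := v) (by simpa using hv) ?_
    simp only [eval_sub, eval_C, eval_mul, eval_X, time]
    rw [side_of_mem_M hS hv, ← mul_assoc, hsq]
    ring
  · have h1 := hg (time v)
    have h2 := hg (time w)
    rw [hother v hv] at h1
    rw [hother w hw] at h2
    have hne : S.toFinite.toFinset.Nonempty := by
      rw [← Finset.card_pos, hcard]
      omega
    have hlt' : (node v : ℝ) < node w := by exact_mod_cast hlt
    have h3 := Finset.prod_lt_prod_of_nonempty (s := S.toFinite.toFinset)
      (f := fun z : Vertex k => (node z : ℝ) + node v) (g := fun z => (node z : ℝ) + node w)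
      (fun z _ => add_pos (hpos z) (hpos v)) (fun z _ => by linarith) hne
    unfold momentPlacement
    linarith

/-- The sign depends on the pair only, not on `f`; hence the signs for both sides can be fixed
before one functional is chosen for both. -/
theorem exists_strictlySeparates_sign {s : Fin 2} {S S' : Set (Vertex k)} (hS : S ∈ M k s)
    (hS' : S' ∈ M k s) (hne : S ≠ S') :
    ∃ σ : ℝ, (σ = 1 ∨ σ = -1) ∧ ∀ f : Vertex k → ℝ,
      (∀ v w : Vertex k, v.1 = s → w.1 = s → node v < node w → σ * f v < σ * f w) →
      ∃ a : ℝ, StrictlySeparates (fun v => a + f v) S S' := by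
  rcases node_lt_or_lt_of_mem_M hS hS' hne with h | h
  · refine ⟨1, Or.inl rfl, fun f hf => exists_strictlySeparates fun v hv w hw => ?_⟩
    have := hf w v (side_of_mem_M hS' hw) (side_of_mem_M hS hv) (h v hv w hw)
    linarith
  · refine ⟨-1, Or.inr rfl, fun f hf => exists_strictlySeparates fun v hv w hw => ?_⟩
    have := hf v w (side_of_mem_M hS hv) (side_of_mem_M hS' hw) (h v hv w hw)
    linarith

theorem momentPlacement_sep_M_M (hk : 3 ≤ k) (hlast : (last : ℕ) + 1 = 2 * k - 1)
    {S S' T T' : Set (Vertex k)} (hS : S ∈ M k 0) (hS' : S' ∈ M k 0) (hT : T ∈ M k 1)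
    (hT' : T' ∈ M k 1) (hne : S ≠ S' ∨ T ≠ T') :
    ∃ (a₀ a₁ : ℝ) (g : EuclideanSpace ℝ (Fin (2 * k - 1)) →ₗ[ℝ] ℝ),
      g (EuclideanSpace.single last 1) = 0 ∧
      (S = S' ∧ (∀ v ∈ S, a₀ + g (momentPlacement k v) = 0) ∨
        StrictlySeparates (fun v => a₀ + g (momentPlacement k v)) S S') ∧
      (T = T' ∧ (∀ v ∈ T, a₁ + g (momentPlacement k v) = 0) ∨
        StrictlySeparates (fun v => a₁ + g (momentPlacement k v)) T T') := by
  by_cases hSS : S = S'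
  · have hTT := hne.resolve_left (not_not.2 hSS)
    obtain ⟨a, g, hu, hz, hmono⟩ := exists_vanishing_monotone_functional hk hlast hS
    obtain ⟨σ, hσ, hsep⟩ := exists_strictlySeparates_sign hT hT' hTT
    obtain ⟨b, hb⟩ := hsep (fun v => (σ • g) (momentPlacement k v)) fun v w hv hw hlt => by
      have := hmono v w (by rw [hv]; decide) (by rw [hw]; decide) hlt
      rcases hσ with rfl | rfl <;> simpa using this
    refine ⟨σ * a, b, σ • g, by simp [hu], Or.inl ⟨hSS, fun v hv => ?_⟩, Or.inr hb⟩
    rw [LinearMap.smul_apply, smul_eq_mul, ← mul_add, hz v hv, mul_zero]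
  by_cases hTT : T = T'
  · obtain ⟨a, g, hu, hz, hmono⟩ := exists_vanishing_monotone_functional hk hlast hT
    obtain ⟨σ, hσ, hsep⟩ := exists_strictlySeparates_sign hS hS' hSS
    obtain ⟨b, hb⟩ := hsep (fun v => (σ • g) (momentPlacement k v)) fun v w hv hw hlt => by
      have := hmono v w (by rw [hv]; decide) (by rw [hw]; decide) hlt
      rcases hσ with rfl | rfl <;> simpa using this
    refine ⟨b, σ * a, σ • g, by simp [hu], Or.inr hb, Or.inl ⟨hTT, fun v hv => ?_⟩⟩
    rw [LinearMap.smul_apply, smul_eq_mul, ← mul_add, hz v hv, mul_zero]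
  · obtain ⟨σ, hσ, hsep⟩ := exists_strictlySeparates_sign hS hS' hSS
    obtain ⟨τ, hτ, hsep'⟩ := exists_strictlySeparates_sign hT hT' hTT
    obtain ⟨g, hu, hg⟩ := exists_monotone_functional hk hlast σ τ hσ hτ
    obtain ⟨a, ha⟩ := hsep (fun v => g (momentPlacement k v)) fun v w hv hw hlt =>
      (hg v w (hv.trans hw.symm) hlt).1 hv
    obtain ⟨b, hb⟩ := hsep' (fun v => g (momentPlacement k v)) fun v w hv hw hlt =>
      (hg v w (hv.trans hw.symm) hlt).2 hv
    exact ⟨a, b, g, hu, Or.inr ha, Or.inr hb⟩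

/-- The factor `X ^ (k - 1)` only raises the degree to `2 * k - 1`, so that the top coefficient is
`1`. -/
theorem momentPlacement_vanish_M (hk : 1 ≤ k) (hlast : (last : ℕ) + 1 = 2 * k - 1) {s : Fin 2}
    {S : Set (Vertex k)} (hS : S ∈ M k s) :
    ∃ (a : ℝ) (g : EuclideanSpace ℝ (Fin (2 * k - 1)) →ₗ[ℝ] ℝ),
      g (EuclideanSpace.single last 1) = 1 ∧ ∀ v ∈ S, a + g (momentPlacement k v) = 0 := by
  have hcard : S.toFinite.toFinset.card = k := by
    have := S.toFinite.encard_eq_coe_toFinset_card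
    rw [encard_of_mem_M hS] at this
    exact_mod_cast this.symm
  have hPm : (∏ v ∈ S.toFinite.toFinset, (X - C (time v))).Monic :=
    monic_prod_of_monic _ _ fun v _ => monic_X_sub_C _
  have hm := hPm.mul (monic_X_pow (R := ℝ) (k - 1))
  have hd : ((∏ v ∈ S.toFinite.toFinset, (X - C (time v))) * X ^ (k - 1)).natDegree =
      2 * k - 1 := by
    rw [hPm.natDegree_mul (monic_X_pow _), natDegree_finsetProd_X_sub_C_eq_card, natDegree_X_pow,
      hcard]
    omega
  obtain ⟨g, hg, hu⟩ := exists_linear_of_polynomial last hlast _ hd.le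
  refine ⟨_, g, ?_, fun v hv => (hg (time v)).trans ?_⟩
  · exact hu.trans ((congrArg _ hd.symm).trans hm.coeff_natDegree)
  · rw [eval_mul, eval_prod, Finset.prod_eq_zero (i := v) (by simpa using hv) (by simp), zero_mul]

theorem isSeparated_momentPlacement (hk : 3 ≤ k) (hlast : (last : ℕ) + 1 = 2 * k - 1) :
    IsSeparated (momentPlacement k) (EuclideanSpace.single last 1) where
  injOn s v _ w _ h := by
    refine time_injective ?_
    have h0 := congrArg (fun y : EuclideanSpace ℝ (Fin (2 * k - 1)) => y ⟨0, by omega⟩) h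
    simpa [momentPlacement, momentPoint] using h0
  exists_height := ⟨(EuclideanSpace.proj last :
    EuclideanSpace ℝ (Fin (2 * k - 1)) →L[ℝ] ℝ).toLinearMap, by simp⟩
  sep_K_K _ _ hA _ hB := momentPlacement_sep_K_K hlast hA hB
  sep_K_M _ _ hA _ hS := momentPlacement_sep_K_M hk hlast hA hS
  sep_M_M _ hS _ hS' _ hT _ hT' hne := momentPlacement_sep_M_M hk hlast hS hS' hT hT' hne
  vanish_M _ _ hS := momentPlacement_vanish_M (by omega) hlast hS
  indep_K _ _ hA := momentPlacement_affineIndependent hlast (encard_of_mem_K hA)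
  indep_M S hS T hT := by
    -- Before the shift the vertices are distinct points of the moment curve, and the shift adds `R`
    -- times fixed vectors.
    have h := momentPlacement_affineIndependent hlast (encard_union_of_mem_M hS hT)
    filter_upwards [eventually_affineIndependent_add_smul h fun v : ↥(S ∪ T) =>
      if v.1.1 = 0 then 0 else EuclideanSpace.single last 1] with R hR
    convert hR using 2 with v
    unfold shifted
    split_ifs <;> simp

end

end GeomHypergraph

/-! ### The case `k = 2`: arcs in `ℝ^3` and edges of `K` -/

namespace GeomHypergraph

open Filter Module

/-- First coordinates of the directions carrying the three paths of side `0`. -/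
def rayX : Fin 3 → ℝ := ![10, 80, -90]

/-- Second coordinates of the directions carrying the three paths of side `0`. -/
def rayY : Fin 3 → ℝ := ![1, -1, 0]

/-- Curvatures of the three paths. -/
def curv : Fin 3 → ℝ := ![1, 100, 10000]

/-- The index of the path containing a vertex. -/
def pathIndex (v : Vertex 2) : Fin 3 := v.2.1

/-- The position of a vertex on its path, counted from `1`. -/
def radius (v : Vertex 2) : ℕ := (v.2.2 : ℕ) + 1

/-- The placement in `ℝ^3`: the three paths of a side are convex arcs in the vertical half-planes
over three rays of the horizontal plane. The second side is a mirror image of the first. -/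
noncomputable def arcPlacement (v : Vertex 2) : EuclideanSpace ℝ (Fin (2 * 2 - 1)) :=
  if v.1 = 0 then
    WithLp.toLp 2 ![rayX (pathIndex v) * radius v, rayY (pathIndex v) * radius v,
      curv (pathIndex v) * (radius v : ℝ) ^ 2]
  else
    WithLp.toLp 2 ![rayY (pathIndex v) * radius v, rayX (pathIndex v) * radius v,
      -(curv (pathIndex v) * (radius v : ℝ) ^ 2)]

/-- The vertical direction in `ℝ^3`. -/
noncomputable def vertical : EuclideanSpace ℝ (Fin (2 * 2 - 1)) := WithLp.toLp 2 ![0, 0, 1]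

theorem one_le_radius (v : Vertex 2) : 1 ≤ radius v := Nat.le_add_left _ _

theorem radius_le (v : Vertex 2) : radius v ≤ 6 := v.2.2.2

theorem vertex_eq {v w : Vertex 2} (hs : v.1 = w.1) (hi : pathIndex v = pathIndex w)
    (hr : radius v = radius w) : v = w :=
  Prod.ext hs (Prod.ext hi (Fin.ext (Nat.add_right_cancel hr)))

theorem one_le_curv (i : Fin 3) : 1 ≤ curv i := by
  fin_cases i <;> norm_num [curv]

theorem curv_le (i : Fin 3) : curv i ≤ 10000 := by
  fin_cases i <;> norm_num [curv]

theorem curv_growth {i j : Fin 3} (h : i < j) : 100 * curv i ≤ curv j := by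
  fin_cases i <;> fin_cases j <;> first | (exact absurd h (by decide)) | norm_num [curv]

/-- Side `1` swaps the horizontal coordinates and negates heights, so `p` and `q` exchange roles and
the quadratic term changes sign. -/
theorem exists_functional (p q κ : ℝ) :
    ∃ g : EuclideanSpace ℝ (Fin (2 * 2 - 1)) →ₗ[ℝ] ℝ, g vertical = κ ∧ ∀ v : Vertex 2,
      (v.1 = 0 → g (arcPlacement v) =
        (p * rayX (pathIndex v) + q * rayY (pathIndex v)) * radius v +
          κ * (curv (pathIndex v) * (radius v : ℝ) ^ 2)) ∧
      (v.1 = 1 → g (arcPlacement v) =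
        (p * rayY (pathIndex v) + q * rayX (pathIndex v)) * radius v -
          κ * (curv (pathIndex v) * (radius v : ℝ) ^ 2)) := by
  let π (l : Fin 3) : EuclideanSpace ℝ (Fin (2 * 2 - 1)) →ₗ[ℝ] ℝ :=
    (EuclideanSpace.proj l : EuclideanSpace ℝ (Fin (2 * 2 - 1)) →L[ℝ] ℝ).toLinearMap
  have hπ : ∀ (l : Fin 3) (y : Fin 3 → ℝ), π l (WithLp.toLp 2 y) = y l := fun l y => rfl
  refine ⟨p • π 0 + q • π 1 + κ • π 2, ?_, fun v => ⟨fun h => ?_, fun h => ?_⟩⟩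
  · simp only [vertical, LinearMap.add_apply, LinearMap.smul_apply, smul_eq_mul]
    rw [hπ, hπ, hπ]
    simp
  · rw [arcPlacement, if_pos h]
    simp only [LinearMap.add_apply, LinearMap.smul_apply, smul_eq_mul]
    rw [hπ, hπ, hπ]
    simp
    ring
  · rw [arcPlacement, if_neg (by rw [h]; decide)]
    simp only [LinearMap.add_apply, LinearMap.smul_apply, smul_eq_mul]
    rw [hπ, hπ, hπ]
    simp
    ring

/-- The three ray directions span the plane and sum to zero, so the slopes along the rays can be any
numbers with sum zero. -/
theorem exists_functional_side (s : Fin 2) (β : Fin 3 → ℝ) (hβ : β 0 + β 1 + β 2 = 0) (κ : ℝ) :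
    ∃ g : EuclideanSpace ℝ (Fin (2 * 2 - 1)) →ₗ[ℝ] ℝ, g vertical = sideSign s * κ ∧
      ∀ v : Vertex 2, v.1 = s → g (arcPlacement v) =
        β (pathIndex v) * radius v + κ * (curv (pathIndex v) * (radius v : ℝ) ^ 2) := by
  obtain ⟨p, q, hpq⟩ : ∃ p q : ℝ, ∀ i, p * rayX i + q * rayY i = β i := by
    refine ⟨-β 2 / 90, β 0 + β 2 / 9, fun i => ?_⟩
    fin_cases i
    · simp [rayX, rayY]
      ring
    · simp [rayX, rayY]
      linarith
    · simp [rayX, rayY]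
  obtain rfl | rfl := (by omega : s = 0 ∨ s = 1)
  · obtain ⟨g, hu, hg⟩ := exists_functional p q κ
    exact ⟨g, by rw [hu, sideSign_zero, one_mul], fun v hv => by rw [(hg v).1 hv, hpq]⟩
  · obtain ⟨g, hu, hg⟩ := exists_functional q p (-κ)
    refine ⟨g, by rw [hu, sideSign_one, neg_one_mul], fun v hv => ?_⟩
    rw [(hg v).2 hv, ← hpq]
    ring

theorem exists_balanced (l p : Fin 3) (hlp : l ≠ p) (y z : ℝ) :
    ∃ β : Fin 3 → ℝ, β 0 + β 1 + β 2 = 0 ∧ β l = y ∧ β p = z ∧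
      ∀ q, q ≠ l → q ≠ p → β q = -y - z := by
  refine ⟨fun t => if t = l then y else if t = p then z else -y - z, ?_, by simp,
    by simp [hlp.symm], fun q hl hp => by simp [hl, hp]⟩
  fin_cases l <;> fin_cases p <;> first | (exact absurd rfl hlp) | skip
  all_goals
    simp
    try ring

/-- Two pairs of consecutive vertices on two paths. -/
def pairSet (s : Fin 2) (i : Fin 3) (m : ℕ) (j : Fin 3) (n : ℕ) : Set (Vertex 2) :=
  {v | v.1 = s ∧ (pathIndex v = i ∧ (radius v = m ∨ radius v = m + 1) ∨
    pathIndex v = j ∧ (radius v = n ∨ radius v = n + 1))}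

theorem pairSet_comm (s : Fin 2) (i : Fin 3) (m : ℕ) (j : Fin 3) (n : ℕ) :
    pairSet s i m j n = pairSet s j n i m := by
  ext v
  simp only [pairSet, Set.mem_ofPred_eq, or_comm]

theorem exists_pairSet_of_mem_K {s : Fin 2} {A : Set (Vertex 2)} (hA : A ∈ K 2 s) :
    ∃ (i j : Fin 3) (m n : ℕ), i < j ∧ 1 ≤ m ∧ m ≤ 5 ∧ 1 ≤ n ∧ n ≤ 5 ∧
      A = pairSet s i m j n := by
  obtain ⟨ι, a, b, hι, hab, rfl⟩ := mem_K_iff.1 hA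
  have hb0 := (b 0).2
  have hb1 := (b 1).2
  have h0 := hab 0
  have h1 := hab 1
  refine ⟨ι 0, ι 1, a 0 + 1, a 1 + 1, hι (by decide), by omega, by omega, by omega, by omega, ?_⟩
  ext ⟨s', i, j⟩
  simp only [pairSet, Set.mem_ofPred_eq, Fin.exists_fin_two, Prod.mk.injEq, pathIndex, radius,
    Fin.ext_iff (a := j), h0, h1]
  constructor
  · rintro ((⟨rfl, rfl, h⟩ | ⟨rfl, rfl, h⟩) | ⟨rfl, rfl, h⟩ | ⟨rfl, rfl, h⟩)
    · exact ⟨rfl, Or.inl ⟨rfl, by omega⟩⟩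
    · exact ⟨rfl, Or.inl ⟨rfl, by omega⟩⟩
    · exact ⟨rfl, Or.inr ⟨rfl, by omega⟩⟩
    · exact ⟨rfl, Or.inr ⟨rfl, by omega⟩⟩
  · rintro ⟨rfl, ⟨rfl, h⟩ | ⟨rfl, h⟩⟩
    · left
      rcases h with h | h
      · exact Or.inl ⟨rfl, rfl, by omega⟩
      · exact Or.inr ⟨rfl, rfl, by omega⟩
    · right
      rcases h with h | h
      · exact Or.inl ⟨rfl, rfl, by omega⟩
      · exact Or.inr ⟨rfl, rfl, by omega⟩

theorem mem_half_two {s : Fin 2} {i : Fin 3} {h : Fin 2} {v : Vertex 2} :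
    v ∈ half 2 s i h ↔ v.1 = s ∧ pathIndex v = i ∧
      (radius v = 3 * h + 1 ∨ radius v = 3 * h + 3) := by
  refine and_congr Iff.rfl (and_congr Iff.rfl ?_)
  unfold radius
  constructor
  · rintro ⟨m, hm, h⟩
    omega
  · rintro (h | h)
    · exact ⟨0, by omega, by omega⟩
    · exact ⟨1, by omega, by omega⟩

theorem arcPlacement_injOn (s : Fin 2) : Set.InjOn arcPlacement {v | v.1 = s} := by
  intro v hv w hw h
  have hval : ∀ (β : Fin 3 → ℝ), β 0 + β 1 + β 2 = 0 →
      β (pathIndex v) * radius v = β (pathIndex w) * radius w := by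
    intro β hβ
    obtain ⟨g, -, hg⟩ := exists_functional_side s β hβ 0
    have := congrArg g h
    rw [hg v hv, hg w hw] at this
    simpa using this
  have hv1 : (1 : ℝ) ≤ radius v := by exact_mod_cast one_le_radius v
  have hw1 : (1 : ℝ) ≤ radius w := by exact_mod_cast one_le_radius w
  have hi : pathIndex v = pathIndex w := by
    by_contra hne
    obtain ⟨β, hβ, h1, h2, -⟩ := exists_balanced _ _ hne 1 (-1)
    have := hval β hβ
    rw [h1, h2] at this
    linarith
  refine vertex_eq (hv.trans hw.symm) hi ?_
  obtain ⟨l, hl⟩ : ∃ l, pathIndex w ≠ l := by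
    generalize pathIndex w = i
    revert i
    decide
  obtain ⟨β, hβ, h1, -, -⟩ := exists_balanced _ _ hl 1 0
  have := hval β hβ
  rw [hi, h1, one_mul, one_mul] at this
  exact_mod_cast this

theorem consecutive_mul_nonneg (r m : ℕ) : (0 : ℝ) ≤ ((r : ℝ) - m) * ((r : ℝ) - m - 1) := by
  rcases le_or_gt r m with h | h
  · have : (r : ℝ) ≤ m := by exact_mod_cast h
    exact mul_nonneg_of_nonpos_of_nonpos (by linarith) (by linarith)
  · have : (m : ℝ) + 1 ≤ r := by exact_mod_cast h
    exact mul_nonneg (by linarith) (by linarith)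

theorem consecutive_mul_eq_zero {r m : ℕ} :
    ((r : ℝ) - m) * ((r : ℝ) - m - 1) = 0 ↔ r = m ∨ r = m + 1 := by
  rw [mul_eq_zero, sub_eq_zero, sub_sub, sub_eq_zero]
  exact or_congr Nat.cast_inj (by exact_mod_cast Iff.rfl)

/-- Weights making the two quadratics with zeros at the two pairs compatible. -/
theorem exists_weights {i j : Fin 3} (hij : i < j) {m n : ℕ} (hm : 1 ≤ m) (hm5 : m ≤ 5)
    (hn : 1 ≤ n) :
    ∃ x y : ℝ, 0 < x ∧ 0 < y ∧ x * (m * (m + 1)) = y * (n * (n + 1)) ∧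
      curv j * x - curv i * y = 1 := by
  have hm1 : (1 : ℝ) ≤ m := by exact_mod_cast hm
  have hm5' : (m : ℝ) ≤ 5 := by exact_mod_cast hm5
  have hn1 : (1 : ℝ) ≤ n := by exact_mod_cast hn
  have hc := curv_growth hij
  have hc1 := one_le_curv i
  have hmm : (m : ℝ) * (m + 1) ≤ 30 := by nlinarith
  have hnn : (2 : ℝ) ≤ n * (n + 1) := by nlinarith
  -- The curvature ratio of at least `100` beats the ratio `30 / 2` of the two products.
  have hD : 0 < curv j * (n * (n + 1)) - curv i * (m * (m + 1)) := by
    have h1 : curv i * (m * (m + 1)) ≤ curv i * 30 :=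
      mul_le_mul_of_nonneg_left hmm (by linarith)
    have h2 : curv j * 2 ≤ curv j * (n * (n + 1)) :=
      mul_le_mul_of_nonneg_left hnn (by linarith)
    linarith
  refine ⟨n * (n + 1) / (curv j * (n * (n + 1)) - curv i * (m * (m + 1))),
    m * (m + 1) / (curv j * (n * (n + 1)) - curv i * (m * (m + 1))), by positivity, by positivity,
    by ring, ?_⟩
  rw [mul_div_assoc', mul_div_assoc', ← sub_div, div_self hD.ne']

/-- Weighted quadratics with zeros at the pairs replace the monic polynomials of the moment curve.
The weight equations make the constant terms of the two differences agree and their leading terms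
proportional to the curvatures; the linear terms are free. -/
theorem arcPlacement_sep_same {s : Fin 2} {i j : Fin 3} (hij : i < j) {m n m' n' : ℕ}
    (hm : 1 ≤ m) (hm5 : m ≤ 5) (hn : 1 ≤ n) (hm' : 1 ≤ m') (hm5' : m' ≤ 5) (hn' : 1 ≤ n') :
    ∃ (a : ℝ) (g : EuclideanSpace ℝ (Fin (2 * 2 - 1)) →ₗ[ℝ] ℝ),
      Separates (fun v => a + g (arcPlacement v)) (pairSet s i m j n) (pairSet s i m' j n') := by
  obtain ⟨x, y, hx, hy, hxy, hc⟩ := exists_weights hij hm hm5 hn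
  obtain ⟨x', y', hx', hy', hxy', hc'⟩ := exists_weights hij hm' hm5' hn'
  have hci : curv i ≠ 0 := (zero_lt_one.trans_le (one_le_curv i)).ne'
  obtain ⟨β, hβ, hβi, hβj, -⟩ := exists_balanced i j hij.ne
    (x * (2 * m + 1) - x' * (2 * m' + 1)) (y * (2 * n + 1) - y' * (2 * n' + 1))
  obtain ⟨g, -, hg⟩ := exists_functional_side s β hβ ((x' - x) / curv i)
  set a := x' * (m' * (m' + 1)) - x * (m * (m + 1)) with ha
  have hvi : ∀ v : Vertex 2, v.1 = s → pathIndex v = i → a + g (arcPlacement v) =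
      x' * (((radius v : ℝ) - m') * ((radius v : ℝ) - m' - 1)) -
      x * (((radius v : ℝ) - m) * ((radius v : ℝ) - m - 1)) := by
    intro v hv hi
    rw [hg v hv, hi, hβi, ha]
    linear_combination (radius v : ℝ) ^ 2 * div_mul_cancel₀ (x' - x) hci
  have hκ : (x' - x) / curv i * curv j = y' - y := by
    field_simp
    linarith
  have hvj : ∀ v : Vertex 2, v.1 = s → pathIndex v = j → a + g (arcPlacement v) =
      y' * (((radius v : ℝ) - n') * ((radius v : ℝ) - n' - 1)) -
      y * (((radius v : ℝ) - n) * ((radius v : ℝ) - n - 1)) := by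
    intro v hv hj
    rw [hg v hv, hj, hβj, ha]
    linear_combination (radius v : ℝ) ^ 2 * hκ + hxy' - hxy
  refine ⟨a, g, ?_, ?_, ?_⟩
  · rintro v ⟨hv, ⟨hi, hr⟩ | ⟨hj, hr⟩⟩
    · beta_reduce
      rw [hvi v hv hi, consecutive_mul_eq_zero.2 hr, mul_zero, sub_zero]
      exact mul_nonneg hx'.le (consecutive_mul_nonneg _ _)
    · beta_reduce
      rw [hvj v hv hj, consecutive_mul_eq_zero.2 hr, mul_zero, sub_zero]
      exact mul_nonneg hy'.le (consecutive_mul_nonneg _ _)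
  · rintro v ⟨hv, ⟨hi, hr⟩ | ⟨hj, hr⟩⟩
    · beta_reduce
      rw [hvi v hv hi, consecutive_mul_eq_zero.2 hr, mul_zero, zero_sub, neg_nonpos]
      exact mul_nonneg hx.le (consecutive_mul_nonneg _ _)
    · beta_reduce
      rw [hvj v hv hj, consecutive_mul_eq_zero.2 hr, mul_zero, zero_sub, neg_nonpos]
      exact mul_nonneg hy.le (consecutive_mul_nonneg _ _)
  · rintro v ⟨hv, ⟨hi, hr⟩ | ⟨hj, hr⟩⟩ h0
    · beta_reduce at h0
      rw [hvi v hv hi, consecutive_mul_eq_zero.2 hr, mul_zero, sub_zero] at h0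
      exact ⟨hv, Or.inl ⟨hi, consecutive_mul_eq_zero.1
        ((mul_eq_zero.1 h0).resolve_left hx'.ne')⟩⟩
    · beta_reduce at h0
      rw [hvj v hv hj, consecutive_mul_eq_zero.2 hr, mul_zero, sub_zero] at h0
      exact ⟨hv, Or.inr ⟨hj, consecutive_mul_eq_zero.1
        ((mul_eq_zero.1 h0).resolve_left hy'.ne')⟩⟩

/-- Pairs of consecutive integers are separated by an affine function of slope at most `1`. -/
theorem exists_slope (m m' : ℕ) (hm' : m' ≤ 5) :
    ∃ ε ρ : ℝ, |ε| ≤ 1 ∧ |ε * ρ| ≤ 6 ∧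
      (∀ r : ℕ, r = m ∨ r = m + 1 → 0 ≤ ε * r - ε * ρ) ∧
      (∀ r : ℕ, r = m' ∨ r = m' + 1 → ε * r - ε * ρ ≤ 0) ∧
      ∀ r : ℕ, r = m ∨ r = m + 1 → ε * r - ε * ρ = 0 → r = m' ∨ r = m' + 1 := by
  have hm5 : (m' : ℝ) ≤ 5 := by exact_mod_cast hm'
  have hm0 : (0 : ℝ) ≤ m' := Nat.cast_nonneg _
  rcases lt_trichotomy m m' with h | rfl | h
  · refine ⟨-1, m', by simp, by rw [abs_le]; constructor <;> linarith, fun r hr => ?_,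
      fun r hr => ?_, fun r hr h0 => ?_⟩
    · have : (r : ℝ) ≤ m' := by exact_mod_cast (by omega : r ≤ m')
      linarith
    · have : (m' : ℝ) ≤ r := by exact_mod_cast (by omega : m' ≤ r)
      linarith
    · left
      exact_mod_cast (by linarith : (r : ℝ) = m')
  · exact ⟨0, 0, by simp, by simp, fun r _ => by simp, fun r _ => by simp, fun r hr _ => hr⟩
  · refine ⟨1, m' + 1, by simp, by rw [abs_le]; constructor <;> linarith, fun r hr => ?_,
      fun r hr => ?_, fun r hr h0 => ?_⟩
    · have : (m' + 1 : ℝ) ≤ r := by exact_mod_cast (by omega : m' + 1 ≤ r)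
      linarith
    · have : (r : ℝ) ≤ m' + 1 := by exact_mod_cast (by omega : r ≤ m' + 1)
      linarith
    · right
      exact_mod_cast (by linarith : (r : ℝ) = m' + 1)

/-- A functional without vertical part suffices: slope `100` on `p` forces slope `-100 - ε` on `q`,
both too steep to be offset by the constant, and on the shared path it is the affine function from
`exists_slope`. -/
theorem arcPlacement_sep_sharing {s : Fin 2} {l p q : Fin 3} (hlp : l ≠ p) (hlq : l ≠ q)
    (hpq : p ≠ q) {m n m' n' : ℕ} (hm' : m' ≤ 5) :
    ∃ (a : ℝ) (g : EuclideanSpace ℝ (Fin (2 * 2 - 1)) →ₗ[ℝ] ℝ),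
      Separates (fun v => a + g (arcPlacement v)) (pairSet s l m p n) (pairSet s l m' q n') := by
  obtain ⟨ε, ρ, hε, hερ, h1, h2, h3⟩ := exists_slope m m' hm'
  rw [abs_le] at hε hερ
  obtain ⟨β, hβ, hβl, hβp, hβ'⟩ := exists_balanced l p hlp ε 100
  have hβq := hβ' q hlq.symm hpq.symm
  obtain ⟨g, -, hg⟩ := exists_functional_side s β hβ 0
  have hvl : ∀ v : Vertex 2, v.1 = s → pathIndex v = l →
      -(ε * ρ) + g (arcPlacement v) = ε * radius v - ε * ρ := by
    intro v hv hl
    rw [hg v hv, hl, hβl]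
    ring
  have hvp : ∀ v : Vertex 2, v.1 = s → pathIndex v = p →
      0 < -(ε * ρ) + g (arcPlacement v) := by
    intro v hv hp
    have hr : (1 : ℝ) ≤ radius v := by exact_mod_cast one_le_radius v
    rw [hg v hv, hp, hβp]
    linarith
  have hvq : ∀ v : Vertex 2, v.1 = s → pathIndex v = q →
      -(ε * ρ) + g (arcPlacement v) < 0 := by
    intro v hv hq
    have hr : (1 : ℝ) ≤ radius v := by exact_mod_cast one_le_radius v
    rw [hg v hv, hq, hβq]
    nlinarith
  refine ⟨-(ε * ρ), g, ?_, ?_, ?_⟩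
  · rintro v ⟨hv, ⟨hl, hr⟩ | ⟨hp, hr⟩⟩
    · beta_reduce
      rw [hvl v hv hl]
      exact h1 _ hr
    · exact (hvp v hv hp).le
  · rintro v ⟨hv, ⟨hl, hr⟩ | ⟨hq, hr⟩⟩
    · beta_reduce
      rw [hvl v hv hl]
      exact h2 _ hr
    · exact (hvq v hv hq).le
  · rintro v ⟨hv, ⟨hl, hr⟩ | ⟨hp, hr⟩⟩ h0
    · beta_reduce at h0
      rw [hvl v hv hl] at h0
      exact ⟨hv, Or.inl ⟨hl, h3 _ hr h0⟩⟩
    · exact absurd h0 (hvp v hv hp).ne'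

/-- Two pairs chosen from three paths always share a path. -/
theorem arcPlacement_sep_K_K {s : Fin 2} {A B : Set (Vertex 2)} (hA : A ∈ K 2 s)
    (hB : B ∈ K 2 s) :
    ∃ (a : ℝ) (g : EuclideanSpace ℝ (Fin (2 * 2 - 1)) →ₗ[ℝ] ℝ),
      Separates (fun v => a + g (arcPlacement v)) A B := by
  obtain ⟨i, j, m, n, hij, hm, hm5, hn, hn5, rfl⟩ := exists_pairSet_of_mem_K hA
  obtain ⟨i', j', m', n', hij', hm', hm5', hn', hn5', rfl⟩ := exists_pairSet_of_mem_K hB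
  by_cases hi : i = i'
  · subst hi
    by_cases hj : j = j'
    · subst hj
      exact arcPlacement_sep_same hij hm hm5 hn hm' hm5' hn'
    · exact arcPlacement_sep_sharing hij.ne hij'.ne hj hm5'
  · by_cases hj : j = j'
    · subst hj
      rw [pairSet_comm s i, pairSet_comm s i']
      exact arcPlacement_sep_sharing hij.ne' hij'.ne' hi hn5'
    · by_cases hij2 : i = j'
      · subst hij2
        rw [pairSet_comm s i']
        exact arcPlacement_sep_sharing hij.ne hij'.ne' (by omega) hn5'
      · have hji : j = i' := by omega
        subst hji
        rw [pairSet_comm s i]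
        exact arcPlacement_sep_sharing hij.ne' hij'.ne (by omega) hm5'

end GeomHypergraph

/-! ### The case `k = 2`: matching sets and affine independence -/

namespace GeomHypergraph

open Filter Module

/-- An interval around a pair of consecutive positions that contains no position of a given half
in its interior; its endpoints belong to the pair only where they belong to the half. -/
theorem exists_interval (m : ℕ) (hm : 1 ≤ m) (hm5 : m ≤ 5) (h : Fin 2) :
    ∃ x y : ℤ, 0 ≤ x ∧ x ≤ y ∧ y ≤ 14 ∧
      (∀ r : ℕ, r = m ∨ r = m + 1 →
        (x < 2 * r ∧ 2 * (r : ℤ) < y) ∨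
          (2 * (r : ℤ) = x ∨ 2 * (r : ℤ) = y) ∧ (r = 3 * h + 1 ∨ r = 3 * h + 3)) ∧
      ∀ r : ℕ, r = 3 * h + 1 ∨ r = 3 * h + 3 → 2 * (r : ℤ) ≤ x ∨ y ≤ 2 * r := by
  obtain rfl | rfl := (by omega : h = 0 ∨ h = 1)
  · rcases (by omega : m = 1 ∨ m = 2 ∨ m = 3 ∨ 4 ≤ m) with rfl | rfl | rfl | h4
    · exact ⟨2, 5, by omega, by omega, by omega, fun r hr => by simp; omega,
        fun r hr => by simp at hr; omega⟩
    · exact ⟨3, 6, by omega, by omega, by omega, fun r hr => by simp; omega,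
        fun r hr => by simp at hr; omega⟩
    · exact ⟨6, 14, by omega, by omega, by omega, fun r hr => by simp; omega,
        fun r hr => by simp at hr; omega⟩
    · exact ⟨7, 14, by omega, by omega, by omega, fun r hr => by simp; omega,
        fun r hr => by simp at hr; omega⟩
  · rcases (by omega : m ≤ 2 ∨ m = 3 ∨ m = 4 ∨ m = 5) with h2 | rfl | rfl | rfl
    · exact ⟨0, 7, by omega, by omega, by omega, fun r hr => by simp; omega,
        fun r hr => by simp at hr; omega⟩
    · exact ⟨0, 8, by omega, by omega, by omega, fun r hr => by simp; omega,
        fun r hr => by simp at hr; omega⟩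
    · exact ⟨8, 11, by omega, by omega, by omega, fun r hr => by simp; omega,
        fun r hr => by simp at hr; omega⟩
    · exact ⟨9, 12, by omega, by omega, by omega, fun r hr => by simp; omega,
        fun r hr => by simp at hr; omega⟩

/-- On arc `l` the functional is a concave quadratic with roots `x / 2` and `y / 2`, concavity
giving the sign on `vertical`. The slope `10000000` on `p` outweighs the other terms, which are at
most `10000 * 49` and `10000 * 36`. -/
theorem arcPlacement_sep_half_of_mem {s : Fin 2} {l p : Fin 3} (hlp : l ≠ p) {m n : ℕ}
    (hm : 1 ≤ m) (hm5 : m ≤ 5) (h : Fin 2) :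
    ∃ (a : ℝ) (g : EuclideanSpace ℝ (Fin (2 * 2 - 1)) →ₗ[ℝ] ℝ),
      sideSign s * g vertical < 0 ∧
      Separates (fun v => a + g (arcPlacement v)) (pairSet s l m p n) (half 2 s l h) := by
  obtain ⟨x, y, hx, hxy, hy, hA, hS⟩ := exists_interval m hm hm5 h
  have hx' : (0 : ℝ) ≤ x := by exact_mod_cast hx
  have hxy' : (x : ℝ) ≤ y := by exact_mod_cast hxy
  have hy' : (y : ℝ) ≤ 14 := by exact_mod_cast hy
  have hcl := one_le_curv l
  have hcl' := curv_le l
  obtain ⟨β, hβ, hβl, hβp, -⟩ := exists_balanced l p hlp (curv l * (x / 2 + y / 2)) 10000000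
  obtain ⟨g, hu, hg⟩ := exists_functional_side s β hβ (-1)
  have hvl : ∀ v : Vertex 2, v.1 = s → pathIndex v = l →
      -(curv l * (x / 2 * (y / 2))) + g (arcPlacement v) =
        curv l * (((radius v : ℝ) - x / 2) * (y / 2 - radius v)) := by
    intro v hv hl
    rw [hg v hv, hl, hβl]
    ring
  have hvp : ∀ v : Vertex 2, v.1 = s → pathIndex v = p →
      0 < -(curv l * (x / 2 * (y / 2))) + g (arcPlacement v) := by
    intro v hv hp
    have hr : (1 : ℝ) ≤ radius v := by exact_mod_cast one_le_radius v
    have hr6 : (radius v : ℝ) ≤ 6 := by exact_mod_cast radius_le v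
    rw [hg v hv, hp, hβp]
    have h1 : (x : ℝ) / 2 * (y / 2) ≤ 49 := by nlinarith
    have h2 : curv l * (x / 2 * (y / 2)) ≤ 10000 * 49 :=
      mul_le_mul hcl' h1 (mul_nonneg (by linarith) (by linarith)) (by norm_num)
    have h3 : (radius v : ℝ) ^ 2 ≤ 36 := by nlinarith
    have h4 : curv p * (radius v : ℝ) ^ 2 ≤ 10000 * 36 :=
      mul_le_mul (curv_le p) h3 (by positivity) (by norm_num)
    linarith
  refine ⟨-(curv l * (x / 2 * (y / 2))), g, ?_, ?_, ?_, ?_⟩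
  · rw [hu]
    obtain rfl | rfl := (by omega : s = 0 ∨ s = 1) <;> simp
  · rintro v ⟨hv, ⟨hl, hr⟩ | ⟨hp, hr⟩⟩
    · beta_reduce
      rw [hvl v hv hl]
      have h1 : (x : ℝ) ≤ 2 * radius v := by exact_mod_cast (by have := hA _ hr; omega)
      have h2 : 2 * (radius v : ℝ) ≤ y := by exact_mod_cast (by have := hA _ hr; omega)
      exact mul_nonneg (by linarith) (mul_nonneg (by linarith) (by linarith))
    · exact (hvp v hv hp).le
  · intro v hv
    obtain ⟨hv, hl, hr⟩ := mem_half_two.1 hv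
    beta_reduce
    rw [hvl v hv hl]
    refine mul_nonpos_of_nonneg_of_nonpos (by linarith) ?_
    rcases hS _ hr with h1 | h1
    · have h1 : 2 * (radius v : ℝ) ≤ x := by exact_mod_cast h1
      exact mul_nonpos_of_nonpos_of_nonneg (by linarith) (by linarith)
    · have h1 : (y : ℝ) ≤ 2 * radius v := by exact_mod_cast h1
      exact mul_nonpos_of_nonneg_of_nonpos (by linarith) (by linarith)
  · rintro v ⟨hv, ⟨hl, hr⟩ | ⟨hp, hr⟩⟩ h0
    · beta_reduce at h0
      rw [hvl v hv hl] at h0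
      rcases hA _ hr with ⟨h1, h2⟩ | ⟨-, h1⟩
      · have h1 : (x : ℝ) < 2 * radius v := by exact_mod_cast h1
        have h2 : 2 * (radius v : ℝ) < y := by exact_mod_cast h2
        exact absurd h0 (mul_pos (by linarith) (mul_pos (by linarith) (by linarith))).ne'
      · exact mem_half_two.2 ⟨hv, hl, h1⟩
    · exact absurd h0 (hvp v hv hp).ne'

/-- Slopes `1, 1` force slope `-2` on path `l`. The tiny vertical coefficient fixes the sign on
`vertical` and contributes at most `0.36` in absolute value. -/
theorem arcPlacement_sep_half_of_notMem {s : Fin 2} {i j l : Fin 3} (hij : i ≠ j) (hli : l ≠ i)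
    (hlj : l ≠ j) (m n : ℕ) (h : Fin 2) :
    ∃ (a : ℝ) (g : EuclideanSpace ℝ (Fin (2 * 2 - 1)) →ₗ[ℝ] ℝ),
      sideSign s * g vertical < 0 ∧
      Separates (fun v => a + g (arcPlacement v)) (pairSet s i m j n) (half 2 s l h) := by
  obtain ⟨β, hβ, hβi, hβj, hβ'⟩ := exists_balanced i j hij 1 1
  have hβl := hβ' l hli hlj
  obtain ⟨g, hu, hg⟩ := exists_functional_side s β hβ (-1 / 1000000)
  have hbound : ∀ v : Vertex 2, (1 : ℝ) ≤ radius v ∧ 0 ≤ curv (pathIndex v) * (radius v : ℝ) ^ 2 ∧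
      curv (pathIndex v) * (radius v : ℝ) ^ 2 ≤ 10000 * 36 := by
    intro v
    have hr : (1 : ℝ) ≤ radius v := by exact_mod_cast one_le_radius v
    have hr6 : (radius v : ℝ) ≤ 6 := by exact_mod_cast radius_le v
    have hc := one_le_curv (pathIndex v)
    exact ⟨hr, mul_nonneg (by linarith) (by positivity),
      mul_le_mul (curv_le _) (by nlinarith) (by positivity) (by norm_num)⟩
  refine ⟨0, g, ?_, StrictlySeparates.separates ⟨?_, ?_⟩⟩
  · rw [hu]
    obtain rfl | rfl := (by omega : s = 0 ∨ s = 1) <;> norm_num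
  · intro v hv
    obtain ⟨hv, hv'⟩ := hv
    have hβv : β (pathIndex v) = 1 := by
      rcases hv' with ⟨hp, -⟩ | ⟨hp, -⟩
      · rw [hp, hβi]
      · rw [hp, hβj]
    have := hbound v
    beta_reduce
    rw [hg v hv, hβv]
    linarith
  · intro v hv
    obtain ⟨hv, hl, -⟩ := mem_half_two.1 hv
    have := hbound v
    rw [hl] at this
    beta_reduce
    rw [hg v hv, hl, hβl]
    linarith

theorem arcPlacement_sep_K_M {s : Fin 2} {A S : Set (Vertex 2)} (hA : A ∈ K 2 s)
    (hS : S ∈ M 2 s) :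
    ∃ (a : ℝ) (g : EuclideanSpace ℝ (Fin (2 * 2 - 1)) →ₗ[ℝ] ℝ),
      sideSign s * g vertical < 0 ∧ Separates (fun v => a + g (arcPlacement v)) A S := by
  obtain ⟨i, j, m, n, hij, hm, hm5, hn, hn5, rfl⟩ := exists_pairSet_of_mem_K hA
  obtain ⟨l, h, rfl⟩ := mem_M_iff.1 hS
  by_cases hli : l = i
  · subst hli
    exact arcPlacement_sep_half_of_mem hij.ne hm hm5 h
  · by_cases hlj : l = j
    · subst hlj
      rw [pairSet_comm]
      exact arcPlacement_sep_half_of_mem hij.ne' hn hn5 h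
    · exact arcPlacement_sep_half_of_notMem hij.ne hli hlj m n h

/-- Slopes for which the members of `M` appear in a fixed order along the induced functional. -/
def WellSpread (β : Fin 3 → ℝ) : Prop := 0 < β 0 ∧ 6 * β 0 < β 1 ∧ β 2 < 0

/-- The order is path `2` traversed backwards, then path `0`, then path `1`: radii are at most `6`,
so `6 * β 0 < β 1` keeps the last two apart. -/
theorem wellSpread_order {s : Fin 2} {S S' : Set (Vertex 2)} (hS : S ∈ M 2 s) (hS' : S' ∈ M 2 s)
    (hne : S ≠ S') :
    (∀ β, WellSpread β → ∀ v ∈ S, ∀ w ∈ S',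
      β (pathIndex w) * radius w < β (pathIndex v) * radius v) ∨
    ∀ β, WellSpread β → ∀ v ∈ S, ∀ w ∈ S',
      β (pathIndex v) * radius v < β (pathIndex w) * radius w := by
  obtain ⟨i, h, rfl⟩ := mem_M_iff.1 hS
  obtain ⟨i', h', rfl⟩ := mem_M_iff.1 hS'
  have hbound : ∀ (i : Fin 3) (h : Fin 2), ∀ v ∈ half 2 s i h, pathIndex v = i ∧
      (3 * (h : ℕ) + 1 : ℝ) ≤ radius v ∧ (radius v : ℝ) ≤ 3 * (h : ℕ) + 3 := by
    intro i h v hv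
    obtain ⟨-, hi, hr⟩ := mem_half_two.1 hv
    refine ⟨hi, ?_, ?_⟩
    · exact_mod_cast (by omega : 3 * (h : ℕ) + 1 ≤ radius v)
    · exact_mod_cast (by omega : radius v ≤ 3 * (h : ℕ) + 3)
  have key : ∀ (i i' : Fin 3) (h h' : Fin 2),
      (i = 2 ∧ i' ≠ 2 ∨ i = 0 ∧ i' = 1 ∨ i = i' ∧ (i = 2 ∧ h = 1 ∧ h' = 0 ∨
        i ≠ 2 ∧ h = 0 ∧ h' = 1)) →
      ∀ β, WellSpread β → ∀ v ∈ half 2 s i h, ∀ w ∈ half 2 s i' h',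
        β (pathIndex v) * radius v < β (pathIndex w) * radius w := by
    rintro i i' h h' hc β ⟨h0, h1, h2⟩ v hv w hw
    have hrv : (1 : ℝ) ≤ radius v := by exact_mod_cast one_le_radius v
    have hrw : (1 : ℝ) ≤ radius w := by exact_mod_cast one_le_radius w
    have hrv6 : (radius v : ℝ) ≤ 6 := by exact_mod_cast radius_le v
    obtain ⟨hi, hv1, hv2⟩ := hbound i h v hv
    obtain ⟨hi', hw1, hw2⟩ := hbound i' h' w hw
    have hpos : ∀ l : Fin 3, l ≠ 2 → 0 < β l := by
      intro l hl
      obtain rfl | rfl := (by omega : l = 0 ∨ l = 1) <;> linarith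
    rw [hi, hi']
    rcases hc with ⟨rfl, hne⟩ | ⟨rfl, rfl⟩ | ⟨rfl, ⟨rfl, rfl, rfl⟩ | ⟨hne, rfl, rfl⟩⟩
    · have := mul_neg_of_neg_of_pos h2 (by linarith : (0 : ℝ) < radius v)
      have := mul_pos (hpos _ hne) (by linarith : (0 : ℝ) < radius w)
      linarith
    · nlinarith
    · have h4 : (4 : ℝ) ≤ radius v := by norm_num at hv1; exact_mod_cast hv1
      have h3 : (radius w : ℝ) ≤ 3 := by norm_num at hw2; exact_mod_cast hw2
      nlinarith
    · have := hpos _ hne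
      have h3 : (radius v : ℝ) ≤ 3 := by norm_num at hv2; exact_mod_cast hv2
      have h4 : (4 : ℝ) ≤ radius w := by norm_num at hw1; exact_mod_cast hw1
      nlinarith
  have hcases : ∀ (i i' : Fin 3) (h h' : Fin 2), ¬ (i = i' ∧ h = h') →
      (i = 2 ∧ i' ≠ 2 ∨ i = 0 ∧ i' = 1 ∨ i = i' ∧ (i = 2 ∧ h = 1 ∧ h' = 0 ∨
        i ≠ 2 ∧ h = 0 ∧ h' = 1)) ∨
      (i' = 2 ∧ i ≠ 2 ∨ i' = 0 ∧ i = 1 ∨ i' = i ∧ (i' = 2 ∧ h' = 1 ∧ h = 0 ∨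
        i' ≠ 2 ∧ h' = 0 ∧ h = 1)) := by
    intro i i' h h' hne
    omega
  rcases hcases i i' h h' (fun ⟨h1, h2⟩ => hne (by rw [h1, h2])) with hc | hc
  · exact Or.inr (key _ _ _ _ hc)
  · exact Or.inl fun β hβ v hv w hw => key _ _ _ _ hc β hβ w hw v hv

theorem exists_wellSpread_sign {s : Fin 2} {S S' : Set (Vertex 2)} (hS : S ∈ M 2 s)
    (hS' : S' ∈ M 2 s) (hne : S ≠ S') :
    ∃ σ : ℝ, (σ = 1 ∨ σ = -1) ∧ ∀ β, WellSpread β → ∀ f : Vertex 2 → ℝ,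
      (∀ v, v.1 = s → f v = σ * β (pathIndex v) * radius v) →
      ∃ a : ℝ, StrictlySeparates (fun v => a + f v) S S' := by
  rcases wellSpread_order hS hS' hne with h | h
  · refine ⟨1, Or.inl rfl, fun β hβ f hf => exists_strictlySeparates fun v hv w hw => ?_⟩
    have := h β hβ v hv w hw
    rw [hf v (side_of_mem_M hS hv), hf w (side_of_mem_M hS' hw)]
    linarith
  · refine ⟨-1, Or.inr rfl, fun β hβ f hf => exists_strictlySeparates fun v hv w hw => ?_⟩
    have := h β hβ v hv w hw
    rw [hf v (side_of_mem_M hS hv), hf w (side_of_mem_M hS' hw)]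
    linarith

@[simp] theorem rayX_zero : rayX 0 = 10 := rfl

@[simp] theorem rayX_one : rayX 1 = 80 := rfl

@[simp] theorem rayX_two : rayX 2 = -90 := rfl

@[simp] theorem rayY_zero : rayY 0 = 1 := rfl

@[simp] theorem rayY_one : rayY 1 = -1 := rfl

@[simp] theorem rayY_two : rayY 2 = 0 := rfl

/-- The rays of side `0` lie close to the first axis, those of side `1` close to the second. A
functional killing one ray of a side therefore has slopes nearly proportional to `10, 80, -90` on
the other side. -/
theorem exists_wellSpread_of_path (i : Fin 3) :
    ∃ p q : ℝ, p * rayX i + q * rayY i = 0 ∧ WellSpread fun j => p * rayY j + q * rayX j := by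
  fin_cases i
  · exact ⟨-1, 10, by norm_num [rayX, rayY], by norm_num [WellSpread]⟩
  · exact ⟨1, 80, by norm_num [rayX, rayY], by norm_num [WellSpread]⟩
  · exact ⟨0, 1, by norm_num [rayX, rayY], by norm_num [WellSpread]⟩

theorem arcPlacement_sep_M_M {S S' T T' : Set (Vertex 2)} (hS : S ∈ M 2 0) (hS' : S' ∈ M 2 0)
    (hT : T ∈ M 2 1) (hT' : T' ∈ M 2 1) (hne : S ≠ S' ∨ T ≠ T') :
    ∃ (a₀ a₁ : ℝ) (g : EuclideanSpace ℝ (Fin (2 * 2 - 1)) →ₗ[ℝ] ℝ), g vertical = 0 ∧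
      (S = S' ∧ (∀ v ∈ S, a₀ + g (arcPlacement v) = 0) ∨
        StrictlySeparates (fun v => a₀ + g (arcPlacement v)) S S') ∧
      (T = T' ∧ (∀ v ∈ T, a₁ + g (arcPlacement v) = 0) ∨
        StrictlySeparates (fun v => a₁ + g (arcPlacement v)) T T') := by
  by_cases hSS : S = S'
  · obtain ⟨σ, hσ, hsep⟩ :=
      exists_wellSpread_sign hT hT' (hne.resolve_left (not_not.2 hSS))
    obtain ⟨i, h, rfl⟩ := mem_M_iff.1 hS
    obtain ⟨p, q, hz, hw⟩ := exists_wellSpread_of_path i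
    obtain ⟨g, hu, hg⟩ := exists_functional (σ * p) (σ * q) 0
    obtain ⟨b, hb⟩ := hsep _ hw (fun v => g (arcPlacement v)) fun v hv => by
      rw [(hg v).2 hv]
      ring
    refine ⟨0, b, g, hu, Or.inl ⟨hSS, fun v hv => ?_⟩, Or.inr hb⟩
    obtain ⟨hv, hi, -⟩ := mem_half_two.1 hv
    rw [(hg v).1 hv, hi]
    linear_combination σ * (radius v : ℝ) * hz
  by_cases hTT : T = T'
  · obtain ⟨σ, hσ, hsep⟩ := exists_wellSpread_sign hS hS' hSS
    obtain ⟨i, h, rfl⟩ := mem_M_iff.1 hT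
    obtain ⟨p, q, hz, hw⟩ := exists_wellSpread_of_path i
    obtain ⟨g, hu, hg⟩ := exists_functional (σ * q) (σ * p) 0
    obtain ⟨b, hb⟩ := hsep _ hw (fun v => g (arcPlacement v)) fun v hv => by
      rw [(hg v).1 hv]
      ring
    refine ⟨b, 0, g, hu, Or.inr hb, Or.inl ⟨hTT, fun v hv => ?_⟩⟩
    obtain ⟨hv, hi, -⟩ := mem_half_two.1 hv
    rw [(hg v).2 hv, hi]
    linear_combination σ * (radius v : ℝ) * hz
  · obtain ⟨σ, hσ, hsep⟩ := exists_wellSpread_sign hS hS' hSS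
    obtain ⟨τ, hτ, hsep'⟩ := exists_wellSpread_sign hT hT' hTT
    obtain ⟨g, hu, hg⟩ := exists_functional σ τ 0
    -- Up to the factors `σ` and `τ`, both sides see these same slopes; the entries of `rayY` are
    -- too small to upset `6 * 10 < 80`.
    have hw : WellSpread fun i => rayX i + σ * τ * rayY i := by
      rcases hσ with rfl | rfl <;> rcases hτ with rfl | rfl <;>
        norm_num [WellSpread]
    have hσ2 : σ * σ = 1 := by rcases hσ with rfl | rfl <;> norm_num
    have hτ2 : τ * τ = 1 := by rcases hτ with rfl | rfl <;> norm_num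
    obtain ⟨a, ha⟩ := hsep _ hw (fun v => g (arcPlacement v)) fun v hv => by
      rw [(hg v).1 hv]
      linear_combination -(τ * rayY (pathIndex v) * radius v) * hσ2
    obtain ⟨b, hb⟩ := hsep' _ hw (fun v => g (arcPlacement v)) fun v hv => by
      rw [(hg v).2 hv]
      linear_combination -(σ * rayY (pathIndex v) * radius v) * hτ2
    exact ⟨a, b, g, hu, Or.inr ha, Or.inr hb⟩

theorem arcPlacement_vanish_M {s : Fin 2} {S : Set (Vertex 2)} (hS : S ∈ M 2 s) :
    ∃ (a : ℝ) (g : EuclideanSpace ℝ (Fin (2 * 2 - 1)) →ₗ[ℝ] ℝ), g vertical = 1 ∧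
      ∀ v ∈ S, a + g (arcPlacement v) = 0 := by
  obtain ⟨i, h, rfl⟩ := mem_M_iff.1 hS
  obtain ⟨j, hij⟩ : ∃ j : Fin 3, i ≠ j := by
    clear hS
    revert i
    decide
  have hsq : sideSign s * sideSign s = 1 := by
    obtain rfl | rfl := (by omega : s = 0 ∨ s = 1) <;> simp
  set x : ℝ := 3 * (h : ℕ) + 1 with hx
  set y : ℝ := 3 * (h : ℕ) + 3 with hy
  obtain ⟨β, hβ, hβi, -⟩ := exists_balanced i j hij (-(sideSign s * curv i * (x + y))) 0
  obtain ⟨g, hu, hg⟩ := exists_functional_side s β hβ (sideSign s)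
  refine ⟨sideSign s * curv i * (x * y), g, by rw [hu, hsq], fun v hv => ?_⟩
  obtain ⟨hv, hi, hr⟩ := mem_half_two.1 hv
  rw [hg v hv, hi, hβi]
  have h0 : ((radius v : ℝ) - x) * ((radius v : ℝ) - y) = 0 := by
    rcases hr with hr | hr <;> rw [hr, hx, hy] <;> push_cast <;> ring
  linear_combination sideSign s * curv i * h0

/-- The functional is a quadratic with root `r₂` on path `i` and roots `r₃`, `r₄` on path `j`. Equal
constant terms determine its second root `ρ` on path `i`, and `hc` says that `ρ ≠ r₁`. -/
theorem exists_isolating_pair {s : Fin 2} {i j : Fin 3} (hij : i ≠ j) {r₁ r₂ r₃ r₄ : ℝ}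
    (h12 : r₁ ≠ r₂) (hr₂ : r₂ ≠ 0) (hc : curv i * (r₁ * r₂) ≠ curv j * (r₃ * r₄)) :
    ∃ (a : ℝ) (g : EuclideanSpace ℝ (Fin (2 * 2 - 1)) →ₗ[ℝ] ℝ), ∀ v : Vertex 2, v.1 = s →
      (pathIndex v = i → ((radius v : ℝ) = r₁ → a + g (arcPlacement v) ≠ 0) ∧
        ((radius v : ℝ) = r₂ → a + g (arcPlacement v) = 0)) ∧
      (pathIndex v = j → (radius v : ℝ) = r₃ ∨ (radius v : ℝ) = r₄ →
        a + g (arcPlacement v) = 0) := by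
  have hci : curv i ≠ 0 := (zero_lt_one.trans_le (one_le_curv i)).ne'
  set ρ := curv j * (r₃ * r₄) / (curv i * r₂) with hρ
  have hρ' : curv i * (r₂ * ρ) = curv j * (r₃ * r₄) := by
    rw [hρ]
    field_simp
  obtain ⟨β, hβ, hβi, hβj, -⟩ :=
    exists_balanced i j hij (-(curv i * (r₂ + ρ))) (-(curv j * (r₃ + r₄)))
  obtain ⟨g, -, hg⟩ := exists_functional_side s β hβ 1
  refine ⟨curv j * (r₃ * r₄), g, fun v hv => ⟨fun hi => ⟨fun hr => ?_, fun hr => ?_⟩,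
    fun hj hr => ?_⟩⟩
  · rw [hg v hv, hi, hβi, hr]
    have hne : curv i * ((r₁ - r₂) * (r₁ - ρ)) ≠ 0 := by
      refine mul_ne_zero hci (mul_ne_zero (sub_ne_zero.2 h12) (sub_ne_zero.2 fun he => hc ?_))
      rw [← hρ', he]
      ring
    intro h0
    apply hne
    linear_combination h0 + hρ'
  · rw [hg v hv, hi, hβi, hr]
    linear_combination -hρ'
  · rw [hg v hv, hj, hβj]
    have h0 : ((radius v : ℝ) - r₃) * ((radius v : ℝ) - r₄) = 0 := by
      rcases hr with hr | hr <;> rw [hr] <;> ring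
    linear_combination curv j * h0

theorem curv_mul_ne {i j : Fin 3} (hij : i < j) {m n : ℕ} (hm5 : m ≤ 5) (hn : 1 ≤ n) :
    curv i * ((m : ℝ) * (m + 1)) ≠ curv j * ((n : ℝ) * (n + 1)) := by
  have hm5' : (m : ℝ) ≤ 5 := by exact_mod_cast hm5
  have hm0 : (0 : ℝ) ≤ m := Nat.cast_nonneg _
  have hn1 : (1 : ℝ) ≤ n := by exact_mod_cast hn
  have hc := curv_growth hij
  have hc1 := one_le_curv i
  have h1 : curv i * ((m : ℝ) * (m + 1)) ≤ curv i * 30 :=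
    mul_le_mul_of_nonneg_left (by nlinarith) (by linarith)
  have h2 : curv j * 2 ≤ curv j * ((n : ℝ) * (n + 1)) :=
    mul_le_mul_of_nonneg_left (by nlinarith) (by linarith)
  linarith

theorem exists_isolating_of_path {s : Fin 2} {i j : Fin 3} (hij : i ≠ j) {m n : ℕ}
    (hm : 1 ≤ m) (hc : curv i * ((m : ℝ) * (m + 1)) ≠ curv j * ((n : ℝ) * (n + 1)))
    {v : Vertex 2} (hv : v.1 = s) (hi : pathIndex v = i) (hr : radius v = m ∨ radius v = m + 1) :
    ∃ (a : ℝ) (g : EuclideanSpace ℝ (Fin (2 * 2 - 1)) →ₗ[ℝ] ℝ), a + g (arcPlacement v) ≠ 0 ∧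
      ∀ w ∈ pairSet s i m j n, w ≠ v → a + g (arcPlacement w) = 0 := by
  have hm0 : (m : ℝ) ≠ 0 := by exact_mod_cast (by omega : m ≠ 0)
  have hm1 : (m : ℝ) + 1 ≠ 0 := by exact_mod_cast (by omega : m + 1 ≠ 0)
  have hcast : ∀ w : Vertex 2, ∀ l : ℕ, radius w = l + 1 → (radius w : ℝ) = (l : ℝ) + 1 :=
    fun w l h => by rw [h]; push_cast; rfl
  rcases hr with hr | hr
  · obtain ⟨a, g, hg⟩ := exists_isolating_pair (s := s) (r₃ := n) (r₄ := n + 1) hij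
      (by linarith : (m : ℝ) ≠ m + 1) hm1 hc
    refine ⟨a, g, ((hg v hv).1 hi).1 (by rw [hr]), ?_⟩
    rintro w ⟨hw, ⟨hi', hr' | hr'⟩ | ⟨hj, hr'⟩⟩ hwv
    · exact absurd (vertex_eq (hw.trans hv.symm) (hi'.trans hi.symm) (hr'.trans hr.symm)) hwv
    · exact ((hg w hw).1 hi').2 (hcast _ _ hr')
    · exact (hg w hw).2 hj (hr'.imp (fun h => by rw [h]) (hcast _ _))
  · obtain ⟨a, g, hg⟩ := exists_isolating_pair (s := s) (r₃ := n) (r₄ := n + 1) hij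
      (by linarith : (m : ℝ) + 1 ≠ m) hm0 (by rwa [mul_comm ((m : ℝ) + 1)])
    refine ⟨a, g, ((hg v hv).1 hi).1 (hcast _ _ hr), ?_⟩
    rintro w ⟨hw, ⟨hi', hr' | hr'⟩ | ⟨hj, hr'⟩⟩ hwv
    · exact ((hg w hw).1 hi').2 (by rw [hr'])
    · exact absurd (vertex_eq (hw.trans hv.symm) (hi'.trans hi.symm) (hr'.trans hr.symm)) hwv
    · exact (hg w hw).2 hj (hr'.imp (fun h => by rw [h]) (hcast _ _))

theorem arcPlacement_indep_K {s : Fin 2} {A : Set (Vertex 2)} (hA : A ∈ K 2 s) :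
    AffineIndependent ℝ (fun v : A => arcPlacement v) := by
  obtain ⟨i, j, m, n, hij, hm, hm5, hn, hn5, rfl⟩ := exists_pairSet_of_mem_K hA
  have hc := curv_mul_ne hij hm5 hn
  refine affineIndependent_of_isolating fun v hv => ?_
  obtain ⟨hv, ⟨hi, hr⟩ | ⟨hj, hr⟩⟩ := hv
  · exact exists_isolating_of_path hij.ne hm hc hv hi hr
  · rw [pairSet_comm]
    exact exists_isolating_of_path hij.ne' hn hc.symm hv hj hr

theorem exists_plane_functional (i j : Fin 3) (y z : ℝ) :
    ∃ p q : ℝ, p * rayX i + q * rayY i = y ∧ p * rayY j + q * rayX j = z := by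
  have hdet : rayX i * rayX j - rayY i * rayY j ≠ 0 := by
    fin_cases i <;> fin_cases j <;> norm_num [rayX, rayY]
  refine ⟨(y * rayX j - z * rayY i) / (rayX i * rayX j - rayY i * rayY j),
    (z * rayX i - y * rayY j) / (rayX i * rayX j - rayY i * rayY j), ?_, ?_⟩
  · rw [div_mul_eq_mul_div, div_mul_eq_mul_div, ← add_div, div_eq_iff hdet]
    ring
  · rw [div_mul_eq_mul_div, div_mul_eq_mul_div, ← add_div, div_eq_iff hdet]
    ring

/-- The arcs of the two sides bend in opposite directions; `hxy` is the agreement of the constant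
terms after a shift of height `R`. -/
theorem exists_shifted_functional (R : ℝ) (i j : Fin 3) {x y z t : ℝ}
    (hxy : curv i * (x * y) = -(R + curv j * (z * t))) :
    ∃ (a : ℝ) (g : EuclideanSpace ℝ (Fin (2 * 2 - 1)) →ₗ[ℝ] ℝ), ∀ v : Vertex 2,
      (v.1 = 0 → pathIndex v = i → a + g (shifted arcPlacement vertical R v) =
        curv i * (((radius v : ℝ) - x) * ((radius v : ℝ) - y))) ∧
      (v.1 = 1 → pathIndex v = j → a + g (shifted arcPlacement vertical R v) =
        -(curv j * (((radius v : ℝ) - z) * ((radius v : ℝ) - t)))) := by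
  obtain ⟨p, q, hp, hq⟩ :=
    exists_plane_functional i j (-(curv i * (x + y))) (curv j * (z + t))
  obtain ⟨g, hu, hg⟩ := exists_functional p q 1
  refine ⟨curv i * (x * y), g, fun v => ⟨fun hv hi => ?_, fun hv hj => ?_⟩⟩
  · rw [shifted_of_side_zero hv, (hg v).1 hv, hi, hp]
    ring
  · rw [shifted_of_side_one hv, map_add, map_smul, hu, (hg v).2 hv, hj, hq, hxy, smul_eq_mul]
    ring

/-- To isolate a vertex, the other three positions are taken as roots. The opposite bending makes
the remaining root negative for every `R ≥ 0`, so it is not the position of the isolated vertex. -/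
theorem arcPlacement_indep_M {S T : Set (Vertex 2)} (hS : S ∈ M 2 0) (hT : T ∈ M 2 1) {R : ℝ}
    (hR : 0 ≤ R) :
    AffineIndependent ℝ (fun v : ↥(S ∪ T) => shifted arcPlacement vertical R v) := by
  obtain ⟨i, h, rfl⟩ := mem_M_iff.1 hS
  obtain ⟨j, h', rfl⟩ := mem_M_iff.1 hT
  have hpair : ∀ (s : Fin 2) (l : Fin 3) (h : Fin 2), ∀ v ∈ half 2 s l h,
      ∃ x : ℝ, 0 < x ∧ (radius v : ℝ) ≠ x ∧ v.1 = s ∧ pathIndex v = l ∧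
        ∀ w ∈ half 2 s l h, w.1 = s ∧ pathIndex w = l ∧
          (w ≠ v → (radius w : ℝ) = x) ∧ ((radius w : ℝ) = x ∨ radius w = radius v) := by
    intro s l h v hv
    obtain ⟨hvs, hvl, hr⟩ := mem_half_two.1 hv
    have hne : ∀ w ∈ half 2 s l h, w ≠ v → radius w ≠ radius v := by
      intro w hw hwv he
      obtain ⟨hws, hwl, -⟩ := mem_half_two.1 hw
      exact hwv (vertex_eq (hws.trans hvs.symm) (hwl.trans hvl.symm) he)
    -- The two positions of a half, `3 * h + 1` and `3 * h + 3`, add up to `6 * h + 4`.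
    refine ⟨((6 * h + 4 - radius v : ℕ) : ℝ), by exact_mod_cast (by omega),
      by exact_mod_cast (by omega), hvs, hvl, fun w hw => ?_⟩
    obtain ⟨hws, hwl, hrw⟩ := mem_half_two.1 hw
    refine ⟨hws, hwl, fun hwv => ?_, ?_⟩
    · have := hne w hw hwv
      exact_mod_cast (by omega : radius w = 6 * h + 4 - radius v)
    · have : radius w = 6 * h + 4 - radius v ∨ radius w = radius v := by omega
      exact this.imp_left fun h => by exact_mod_cast h
  have hci : 0 < curv i := zero_lt_one.trans_le (one_le_curv i)
  have hcj : 0 < curv j := zero_lt_one.trans_le (one_le_curv j)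
  have hne : ∀ l h s, (half 2 s l h).Nonempty :=
    fun l h s => nonempty_of_mem_M (by norm_num) (mem_M_iff.2 ⟨l, h, rfl⟩)
  refine affineIndependent_of_isolating fun v hv => ?_
  rcases hv with hv | hv
  · obtain ⟨x, hx, hvx, hvs, hvl, hS'⟩ := hpair _ _ _ v hv
    obtain ⟨w, hw⟩ := hne j h' 1
    obtain ⟨z, hz, -, -, -, hT'⟩ := hpair _ _ _ w hw
    have ht : (0 : ℝ) < radius w := by exact_mod_cast one_le_radius w
    set y := -(R + curv j * (z * radius w)) / (curv i * x) with hy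
    have hyneg : y < 0 := div_neg_of_neg_of_pos
      (by have := mul_pos hcj (mul_pos hz ht); linarith) (mul_pos hci hx)
    obtain ⟨a, g, hg⟩ := exists_shifted_functional R i j (x := x) (y := y) (z := z)
      (t := radius w) (by rw [hy]; field_simp)
    refine ⟨a, g, ?_, ?_⟩
    · rw [(hg v).1 hvs hvl]
      have : (0 : ℝ) ≤ radius v := Nat.cast_nonneg _
      exact mul_ne_zero hci.ne' (mul_ne_zero (sub_ne_zero.2 hvx) (by linarith))
    · rintro w' (hw' | hw') hwv
      · obtain ⟨h1, h2, h3, -⟩ := hS' w' hw'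
        rw [(hg w').1 h1 h2, h3 hwv]
        ring
      · obtain ⟨h1, h2, -, h3⟩ := hT' w' hw'
        rw [(hg w').2 h1 h2]
        rcases h3 with h3 | h3 <;> rw [h3] <;> ring
  · obtain ⟨z, hz, hvz, hvs, hvl, hT'⟩ := hpair _ _ _ v hv
    obtain ⟨w, hw⟩ := hne i h 0
    obtain ⟨x, hx, -, -, -, hS'⟩ := hpair _ _ _ w hw
    have ht : (0 : ℝ) < radius w := by exact_mod_cast one_le_radius w
    set t := -(R + curv i * (x * radius w)) / (curv j * z) with htdef
    have htneg : t < 0 := div_neg_of_neg_of_pos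
      (by have := mul_pos hci (mul_pos hx ht); linarith) (mul_pos hcj hz)
    obtain ⟨a, g, hg⟩ := exists_shifted_functional R i j (x := x) (y := radius w) (z := z)
      (t := t) (by rw [htdef]; field_simp; ring)
    refine ⟨a, g, ?_, ?_⟩
    · rw [(hg v).2 hvs hvl]
      have : (0 : ℝ) ≤ radius v := Nat.cast_nonneg _
      exact neg_ne_zero.2 (mul_ne_zero hcj.ne' (mul_ne_zero (sub_ne_zero.2 hvz) (by linarith)))
    · rintro w' (hw' | hw') hwv
      · obtain ⟨h1, h2, -, h3⟩ := hS' w' hw'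
        rw [(hg w').1 h1 h2]
        rcases h3 with h3 | h3 <;> rw [h3] <;> ring
      · obtain ⟨h1, h2, h3, -⟩ := hT' w' hw'
        rw [(hg w').2 h1 h2, h3 hwv]
        ring

theorem isSeparated_arcPlacement : IsSeparated arcPlacement vertical where
  injOn := arcPlacement_injOn
  exists_height := by
    obtain ⟨g, hu, -⟩ := exists_functional 0 0 1
    exact ⟨g, hu⟩
  sep_K_K _ _ hA _ hB := arcPlacement_sep_K_K hA hB
  sep_K_M _ _ hA _ hS := arcPlacement_sep_K_M hA hS
  sep_M_M _ hS _ hS' _ hT _ hT' hne := arcPlacement_sep_M_M hS hS' hT hT' hne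
  vanish_M _ _ hS := arcPlacement_vanish_M hS
  indep_K _ _ hA := arcPlacement_indep_K hA
  indep_M _ hS _ hT := by
    filter_upwards [eventually_ge_atTop 0] with R hR
    exact arcPlacement_indep_M hS hT hR

theorem geometricallyEmbeddable_pathHypergraph {k d : ℕ} (hk : 2 ≤ k) (hd : d = 2 * k - 1) :
    GeometricallyEmbeddable (pathHypergraph k) (d + 1) d := by
  subst hd
  rcases hk.eq_or_lt with rfl | hk3
  · exact geometricallyEmbeddable_of_isSeparated (by norm_num) rfl isSeparated_arcPlacement
  · exact geometricallyEmbeddable_of_isSeparated (by omega) rfl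
      (isSeparated_momentPlacement (last := ⟨2 * k - 2, by omega⟩) hk3 (by simp only; omega))

end GeomHypergraph

theorem proposition4p2 (d : ℕ) (hd : 3 ≤ d) (hodd : Odd d) :
    GeomHypergraph.GeometricallyEmbeddable (GeomHypergraph.L d) (d + 1) d := by
  obtain ⟨m, rfl⟩ := hodd
  exact GeomHypergraph.geometricallyEmbeddable_pathHypergraph
    (k := (2 * m + 1 + 1) / 2) (by omega) (by omega)
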